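/- **Setting.** Let $d\ge 1$ and $M\ge 0$. For a probability measure $\pi$ on $\mathbb R^d$ let $f_\pi(x)=\int \phi_d(x-\theta)\,d\pi(\theta)$, where $\phi_d(x)=(2\pi)^{-d/2}e^{-\|x\|_2^2/2}$, let $P_{f_\pi}$ be the distribution with density $f_\pi$, and let $\mathcal P_{M,d}$ be the set of all $P_{f_\pi}$ with $\mathrm{supp}(\pi)\subseteq[-M,M]^d$. Let $\mathrm{TV}(p,q)=\frac12\int|p-q|$ (densities with respect to a common dominating measure). **Estimator.** Let $n\ge 2$ and $\eta>0$, and let $Q_1,\dots,Q_N$ be probability measures that form an $\eta$-covering of $\mathcal P_{M,d}$ in total variation (every $P\in\mathcal P_{M,d}$ satisfies $\mathrm{TV}(P,Q_i)\le\eta$ for some $i$), where $N$ is at most the smallest cardinality of an $\eta$-covering with centres in $\mathcal P_{M,d}$ (for instance, a covering of minimal cardinality). For $i\ne j$ let $$A_{ij}=\Big\{x:\tfrac{dQ_i}{d(Q_i+Q_j)}(x)\ge\tfrac{dQ_j}{d(Q_i+Q_j)}(x)\Big\}$$ (for any choice of measurable versions), and put $\mathrm{dist}(P_1,P_2)=\max_{i\neq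 j}|P_1(A_{ij})-P_2(A_{ij})|$ (which is $0$ if $N=1$). A Yatracos estimator based on $X_1,\dots,X_n$ is any measurable choice of $$\widehat P\in\operatorname*{arg\,min}_{P'\in\mathcal P_{M,d}}\mathrm{dist}\Big(P',\tfrac1n\sum_{i=1}^n\delta_{X_i}\Big);$$ its density is denoted by $\widehat f$. It is proper, that is, $\widehat P\in\mathcal P_{M,d}$. **Proposition.** Let $d\ge1$, $M\ge0$, $0<a\le b$. There is a constant $C=C(d,M,a,b)>0$ such that the following holds for every $n\ge 2$ and every $\eta$ with $$a\,\frac{\log^{d/2}(n)}{\sqrt n}\le\eta\le b\,\frac{\log^{d/2}(n)}{\sqrt n}.$$ A covering as above exists; for every such covering a Yatracos estimator exists; and every such Yatracos estimator $\widehat f$ satisfies, for every $\epsilon\in[0,1]$, $$\sup_{\pi,Q}\ \mathbb E\big[\mathrm{TV}^2(f_\pi,\widehat f)\big]\le C\Big(\epsilon^2+\frac{\log^{d+1}(n)}{n}\Big),$$ where the expectation is over $X_1,\dots,X_n$ i.i.d. from $(1-\epsilon)P_{f_\pi}+\epsilon Q$, and the supremum is over all probability measures $\pi$ with $\mathrm{supp}(\pi)\subseteq[-M,M]^d$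 and all probability measures $Q$ on $\mathbb R^d$. -/

import Mathlib

open MeasureTheory
open scoped ENNReal

noncomputable section

namespace GaussianMixture

/-- The cube `[-M, M]^d`. -/
def cube (d : ℕ) (M : ℝ) : Set (EuclideanSpace ℝ (Fin d)) :=
  {θ | ∀ i, |θ i| ≤ M}

/-- The standard Gaussian density `φ_d(x) = (2π)^{-d/2} exp(-‖x‖₂² / 2)`. -/
def stdDensity (d : ℕ) (x : EuclideanSpace ℝ (Fin d)) : ℝ :=
  (2 * Real.pi) ^ (-(d : ℝ) / 2) * Real.exp (-‖x‖ ^ 2 / 2)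

/-- The Gaussian location mixture density `f_π(x) = ∫ φ_d(x - θ) dπ(θ)`. -/
def mixtureDensity {d : ℕ} (π : Measure (EuclideanSpace ℝ (Fin d)))
    (x : EuclideanSpace ℝ (Fin d)) : ℝ :=
  ∫ θ, stdDensity d (x - θ) ∂π

/-- The distribution `P_{f_π}` with Lebesgue density `f_π`. -/
def mixture {d : ℕ} (π : Measure (EuclideanSpace ℝ (Fin d))) :
    Measure (EuclideanSpace ℝ (Fin d)) :=
  volume.withDensity fun x => ENNReal.ofReal (mixtureDensity π x)

/-- Mixing distributions: probability measures supported on the (closed) cube `[-M, M]^d`. -/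
def IsMixing {d : ℕ} (M : ℝ) (π : Measure (EuclideanSpace ℝ (Fin d))) : Prop :=
  IsProbabilityMeasure π ∧ π (cube d M)ᶜ = 0

/-- The class `𝒫_{M,d}` of Gaussian location mixtures whose mixing distribution is supported on
`[-M, M]^d`. -/
def mixtureClass (d : ℕ) (M : ℝ) : Set (Measure (EuclideanSpace ℝ (Fin d))) :=
  {P | ∃ π, IsMixing M π ∧ P = mixture π}

/-- The total variation distance `½ ∫ |p - q|`, where `p` and `q` are the densities of `μ` and `ν`
with respect to the dominating measure `μ + ν`. For Gaussian mixtures it equals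
`½ ∫ |f_π - f_η|` with respect to Lebesgue measure, see `tv_mixture`. -/
def tv {Ω : Type*} [MeasurableSpace Ω] (μ ν : Measure Ω) : ℝ :=
  1 / 2 * ∫ x, |(μ.rnDeriv (μ + ν) x).toReal - (ν.rnDeriv (μ + ν) x).toReal| ∂(μ + ν)

/-- `Q_1, …, Q_N` are probability measures forming an `η`-covering of `𝒫_{M,d}` in total
variation. The centres need not belong to `𝒫_{M,d}`. -/
def IsTVCover {d N : ℕ} (M η : ℝ) (Q : Fin N → Measure (EuclideanSpace ℝ (Fin d))) : Prop :=
  (∀ i, IsProbabilityMeasure (Q i)) ∧ ∀ R ∈ mixtureClass d M, ∃ i, tv R (Q i) ≤ η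

/-- The smallest number of elements of `𝒫_{M,d}` that form an `η`-covering of `𝒫_{M,d}` in total
variation. -/
def properCoveringNumber (d : ℕ) (M η : ℝ) : ℕ :=
  sInf {N | ∃ Q : Fin N → Measure (EuclideanSpace ℝ (Fin d)),
    IsTVCover M η Q ∧ ∀ i, Q i ∈ mixtureClass d M}

/-- An economical `η`-covering: it has no more elements than the smallest `η`-covering with centres
in `𝒫_{M,d}`. Coverings of minimal cardinality are economical, whether minimality is understood
among coverings by arbitrary probability measures or among coverings by elements of `𝒫_{M,d}`. -/
def IsEconomicalTVCover {d N : ℕ} (M η : ℝ)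
    (Q : Fin N → Measure (EuclideanSpace ℝ (Fin d))) : Prop :=
  IsTVCover M η Q ∧ N ≤ properCoveringNumber d M η

/-- `(A_ij)` is the Yatracos class of `Q_1, …, Q_N`: for `i ≠ j`, the measurable set `A_ij` is
`{x | dQ_i/d(Q_i+Q_j) (x) ≥ dQ_j/d(Q_i+Q_j) (x)}`, for an arbitrary choice of the versions of these
densities (which are only determined up to `(Q_i+Q_j)`-null sets). -/
def IsYatracosClass {Ω : Type*} [MeasurableSpace Ω] {N : ℕ} (Q : Fin N → Measure Ω)
    (A : Fin N → Fin N → Set Ω) : Prop :=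
  ∀ i j, i ≠ j → MeasurableSet (A i j) ∧
    A i j =ᵐ[Q i + Q j]
      {x | (Q i).rnDeriv (Q i + Q j) x ≥ (Q j).rnDeriv (Q i + Q j) x}

/-- The pseudo-distance `dist(μ, ν) = sup_{i ≠ j} |μ(A_ij) - ν(A_ij)|`. It is `0` if there is no
pair `i ≠ j`. -/
def yatracosDist {Ω : Type*} [MeasurableSpace Ω] {N : ℕ} (A : Fin N → Fin N → Set Ω)
    (μ ν : Measure Ω) : ℝ :=
  sSup {r | ∃ i j, i ≠ j ∧ r = |μ.real (A i j) - ν.real (A i j)|}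

/-- The empirical distribution `(1/n) ∑ δ_{x_i}`. -/
def empirical {Ω : Type*} [MeasurableSpace Ω] {n : ℕ} (x : Fin n → Ω) : Measure Ω :=
  (n : ℝ≥0∞)⁻¹ • ∑ i, Measure.dirac (x i)

/-- `Phat` is a Yatracos estimator for the class `(A_ij)` based on `n` observations: a measurable
choice of a minimizer of `dist(P', P_n)` over `P' ∈ 𝒫_{M,d}`, where `P_n` is the empirical
distribution. -/
def IsYatracosEstimator {d n N : ℕ} (M : ℝ)
    (A : Fin N → Fin N → Set (EuclideanSpace ℝ (Fin d)))
    (Phat : (Fin n → EuclideanSpace ℝ (Fin d)) → Measure (EuclideanSpace ℝ (Fin d))) : Prop :=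
  Measurable Phat ∧
    ∀ x, Phat x ∈ mixtureClass d M ∧
      ∀ P' ∈ mixtureClass d M,
        yatracosDist A (Phat x) (empirical x) ≤ yatracosDist A P' (empirical x)

/-- Huber's contamination model `(1 - ε) P_{f_π} + ε Q`. -/
def huber {d : ℕ} (ε : ℝ) (π Q : Measure (EuclideanSpace ℝ (Fin d))) :
    Measure (EuclideanSpace ℝ (Fin d)) :=
  ENNReal.ofReal (1 - ε) • mixture π + ENNReal.ofReal ε • Q

theorem continuous_stdDensity (d : ℕ) : Continuous (stdDensity d) := by
  unfold stdDensity; fun_prop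

theorem stdDensity_nonneg {d : ℕ} (x : EuclideanSpace ℝ (Fin d)) : 0 ≤ stdDensity d x := by
  unfold stdDensity; positivity

theorem lintegral_stdDensity (d : ℕ) :
    ∫⁻ x, ENNReal.ofReal (stdDensity d x) = 1 := by
  have h := GaussianFourier.integral_rexp_neg_mul_sq_norm
    (V := EuclideanSpace ℝ (Fin d)) (b := 1 / 2) (by norm_num)
  have hpos : (0 : ℝ) < 2 * Real.pi := by positivity
  have hI : ∫ x, stdDensity d x = 1 := by
    unfold stdDensity
    rw [integral_const_mul]
    have : ∀ x : EuclideanSpace ℝ (Fin d), -‖x‖ ^ 2 / 2 = -(1 / 2) * ‖x‖ ^ 2 := by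
      intro x; ring
    simp_rw [this]
    rw [h, finrank_euclideanSpace_fin, show Real.pi / (1 / 2) = 2 * Real.pi by ring,
      ← Real.rpow_add hpos]
    rw [show -(d : ℝ) / 2 + (d : ℝ) / 2 = 0 by ring, Real.rpow_zero]
  rw [← ofReal_integral_eq_lintegral_ofReal _ (ae_of_all _ stdDensity_nonneg), hI]
  · simp
  · by_contra hni
    rw [integral_undef hni] at hI
    norm_num at hI

theorem ofReal_mixtureDensity {d : ℕ} (π : Measure (EuclideanSpace ℝ (Fin d)))
    [IsProbabilityMeasure π] (x : EuclideanSpace ℝ (Fin d)) :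
    ENNReal.ofReal (mixtureDensity π x) = ∫⁻ θ, ENNReal.ofReal (stdDensity d (x - θ)) ∂π := by
  unfold mixtureDensity
  refine ofReal_integral_eq_lintegral_ofReal ?_ (ae_of_all _ fun _ => stdDensity_nonneg _)
  refine Integrable.of_bound (C := (2 * Real.pi) ^ (-(d : ℝ) / 2)) ?_ ?_
  · exact ((continuous_stdDensity d).comp (by fun_prop)).aestronglyMeasurable
  · refine ae_of_all _ fun θ => ?_
    rw [Real.norm_of_nonneg (stdDensity_nonneg _)]
    unfold stdDensity
    refine mul_le_of_le_one_right (by positivity) ?_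
    rw [Real.exp_le_one_iff]
    nlinarith [sq_nonneg ‖x - θ‖]

theorem measurable_ofReal_mixtureDensity {d : ℕ} (π : Measure (EuclideanSpace ℝ (Fin d)))
    [IsProbabilityMeasure π] : Measurable fun x => ENNReal.ofReal (mixtureDensity π x) := by
  simp_rw [ofReal_mixtureDensity π]
  refine Measurable.lintegral_prod_right' (f := fun p :
    EuclideanSpace ℝ (Fin d) × EuclideanSpace ℝ (Fin d) =>
      ENNReal.ofReal (stdDensity d (p.1 - p.2))) ?_
  exact ENNReal.measurable_ofReal.comp
    ((continuous_stdDensity d).measurable.comp (measurable_fst.sub measurable_snd))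

theorem isProbabilityMeasure_mixture {d : ℕ} (π : Measure (EuclideanSpace ℝ (Fin d)))
    [IsProbabilityMeasure π] : IsProbabilityMeasure (mixture π) := by
  refine ⟨?_⟩
  rw [mixture, withDensity_apply _ MeasurableSet.univ, Measure.restrict_univ]
  simp_rw [ofReal_mixtureDensity π]
  rw [lintegral_lintegral_swap]
  · simp_rw [lintegral_sub_right_eq_self (μ := (volume : Measure (EuclideanSpace ℝ (Fin d))))
      (fun x => ENNReal.ofReal (stdDensity d x)), lintegral_stdDensity]
    simp
  · exact (ENNReal.measurable_ofReal.comp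
      ((continuous_stdDensity d).measurable.comp (measurable_fst.sub measurable_snd))).aemeasurable

theorem mixtureDensity_nonneg {d : ℕ} (π : Measure (EuclideanSpace ℝ (Fin d)))
    (x : EuclideanSpace ℝ (Fin d)) : 0 ≤ mixtureDensity π x :=
  integral_nonneg fun _ => stdDensity_nonneg _

/-- For Gaussian mixtures, `tv` is `½ ∫ |f_π - f_η|` with respect to Lebesgue measure. -/
theorem tv_mixture {d : ℕ} (π η : Measure (EuclideanSpace ℝ (Fin d)))
    [IsProbabilityMeasure π] [IsProbabilityMeasure η] :
    tv (mixture π) (mixture η) = 1 / 2 * ∫ x, |mixtureDensity π x - mixtureDensity η x| := by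
  have := isProbabilityMeasure_mixture π
  have := isProbabilityMeasure_mixture η
  have mf := measurable_ofReal_mixtureDensity π
  have mg := measurable_ofReal_mixtureDensity η
  set f := fun x => ENNReal.ofReal (mixtureDensity π x) with hf
  set g := fun x => ENNReal.ofReal (mixtureDensity η x) with hg
  have hsum : mixture π + mixture η = volume.withDensity (f + g) :=
    (withDensity_add_left mf g).symm
  have key : ∀ (μ : Measure (EuclideanSpace ℝ (Fin d))) (u : EuclideanSpace ℝ (Fin d) → ℝ≥0∞),
      Measurable u → IsProbabilityMeasure μ → μ = volume.withDensity u →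
      μ ≪ mixture π + mixture η →
      (fun x => (f + g) x * μ.rnDeriv (mixture π + mixture η) x) =ᵐ[volume] u := by
    intro μ u mu hμ hμu hac
    have hfin : IsFiniteMeasure (mixture π + mixture η) := inferInstance
    have hdec : μ.HaveLebesgueDecomposition (mixture π + mixture η) :=
      Measure.haveLebesgueDecomposition_of_sigmaFinite _ _
    have h1 : (mixture π + mixture η).withDensity (μ.rnDeriv (mixture π + mixture η)) = μ :=
      Measure.withDensity_rnDeriv_eq _ _ hac
    have h2 : volume.withDensity ((f + g) * μ.rnDeriv (mixture π + mixture η)) =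
        volume.withDensity u := by
      rw [withDensity_mul _ (mf.add mg) (Measure.measurable_rnDeriv _ _), ← hsum, h1, hμu]
    refine (withDensity_eq_iff ?_ mu.aemeasurable ?_).1 h2
    · exact ((mf.add mg).mul (Measure.measurable_rnDeriv _ _)).aemeasurable
    · rw [← setLIntegral_univ, ← withDensity_apply _ MeasurableSet.univ]
      change volume.withDensity ((f + g) * μ.rnDeriv (mixture π + mixture η)) Set.univ ≠ ∞
      rw [h2, ← hμu]
      exact measure_ne_top _ _
  have kf := key (mixture π) f mf inferInstance rfl
    (Measure.absolutelyContinuous_of_le (Measure.le_add_right le_rfl))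
  have kg := key (mixture η) g mg inferInstance rfl
    (Measure.absolutelyContinuous_of_le (Measure.le_add_left le_rfl))
  unfold tv
  congr 1
  generalize hp : (mixture π).rnDeriv (mixture π + mixture η) = p at kf ⊢
  generalize hq : (mixture η).rnDeriv (mixture π + mixture η) = q at kg ⊢
  rw [hsum, integral_withDensity_eq_integral_toReal_smul (mf.add mg)
    (ae_of_all _ fun x => by simp [hf, hg])]
  refine integral_congr_ae ?_
  filter_upwards [kf, kg] with x h1 h2
  have e1 : mixtureDensity π x = ((f + g) x).toReal * (p x).toReal := by
    rw [← ENNReal.toReal_mul, h1, hf, ENNReal.toReal_ofReal (mixtureDensity_nonneg _ _)]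
  have e2 : mixtureDensity η x = ((f + g) x).toReal * (q x).toReal := by
    rw [← ENNReal.toReal_mul, h2, hg, ENNReal.toReal_ofReal (mixtureDensity_nonneg _ _)]
  rw [e1, e2, ← mul_sub, abs_mul, abs_of_nonneg ENNReal.toReal_nonneg, smul_eq_mul]

end GaussianMixture

end

open GaussianMixture

/-! ### Total variation as a supremum over events. -/

section TotalVariation

variable {Ω : Type*} [MeasurableSpace Ω]

/-! The Yatracos class contains the extremal set of every pair of centres, so between centres
`yatracosDist` dominates `tv`. Hence the minimizer is within `4 * η` plus twice `yatracosDist A P E`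
of the truth `P`, with `E` the empirical law (`tv_le_of_yatracosDist_le`). Contamination moves
probabilities by at most `ε`, and Hoeffding with a union bound over fewer than `N ^ 2` sets controls
the sampling error at the scale `t ^ 2 ~ log N / n`.

It remains to see that `log N` is of order `log^(d+1) n`. Weighting by the standard Gaussian bounds
`(∫ |f_π - f_π'|)²` by `∫ (f_π - f_π')² / φ`, which is the integral of `exp ⟨θ, θ'⟩` against `(π -
π') ⊗ (π - π')` (`tv_mixture_le`). Expanding the exponential turns this into a weighted sum of
squared moment differences (`tv_mixture_le_of_moments`). On a bounded cube, degrees up to `K ~ log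
n` suffice; rounding the `K ^ d` moments to a grid polynomially fine in `n` gives `exp (O(K ^ d *
log n))` cells (`exists_proper_isTVCover`).

A minimizer exists because mixing distributions on the cube are weakly compact. -/

theorem measureReal_sub_eq_setIntegral_rnDeriv (μ ν : Measure Ω) [IsProbabilityMeasure μ]
    [IsProbabilityMeasure ν] (B : Set Ω) :
    μ.real B - ν.real B = ∫ x in B,
      ((μ.rnDeriv (μ + ν) x).toReal - (ν.rnDeriv (μ + ν) x).toReal) ∂(μ + ν) := by
  have h1 : μ ≪ μ + ν := Measure.absolutelyContinuous_of_le (Measure.le_add_right le_rfl)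
  have h2 : ν ≪ μ + ν := Measure.absolutelyContinuous_of_le (Measure.le_add_left le_rfl)
  rw [integral_sub Measure.integrable_toReal_rnDeriv.integrableOn
    Measure.integrable_toReal_rnDeriv.integrableOn, Measure.setIntegral_toReal_rnDeriv h1,
    Measure.setIntegral_toReal_rnDeriv h2]

theorem integrable_rnDeriv_sub (μ ν : Measure Ω) [IsProbabilityMeasure μ]
    [IsProbabilityMeasure ν] :
    Integrable (fun x => (μ.rnDeriv (μ + ν) x).toReal - (ν.rnDeriv (μ + ν) x).toReal) (μ + ν) :=
  Measure.integrable_toReal_rnDeriv.sub Measure.integrable_toReal_rnDeriv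

/-- The gaps on `B` and on `Bᶜ` are opposite, so the full integral counts the gap twice; the factor
`1 / 2` in `tv` absorbs this. -/
theorem abs_measureReal_sub_le_tv (μ ν : Measure Ω) [IsProbabilityMeasure μ]
    [IsProbabilityMeasure ν] {B : Set Ω} (hB : MeasurableSet B) :
    |μ.real B - ν.real B| ≤ tv μ ν := by
  have hc : μ.real Bᶜ - ν.real Bᶜ = -(μ.real B - ν.real B) := by
    rw [probReal_compl_eq_one_sub hB, probReal_compl_eq_one_sub hB]; ring
  have h1 := abs_integral_le_integral_abs (μ := (μ + ν).restrict B)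
    (f := fun x => (μ.rnDeriv (μ + ν) x).toReal - (ν.rnDeriv (μ + ν) x).toReal)
  have h2 := abs_integral_le_integral_abs (μ := (μ + ν).restrict Bᶜ)
    (f := fun x => (μ.rnDeriv (μ + ν) x).toReal - (ν.rnDeriv (μ + ν) x).toReal)
  rw [← measureReal_sub_eq_setIntegral_rnDeriv] at h1 h2
  rw [hc, abs_neg] at h2
  have h3 := integral_add_compl hB (integrable_rnDeriv_sub μ ν).abs
  unfold tv
  linarith

/-- The total variation distance is attained at the set where the density of `μ` dominates. -/
theorem tv_eq_measureReal_sub (μ ν : Measure Ω) [IsProbabilityMeasure μ]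
    [IsProbabilityMeasure ν] {A : Set Ω} (hA : MeasurableSet A)
    (hAe : A =ᵐ[μ + ν] {x | μ.rnDeriv (μ + ν) x ≥ ν.rnDeriv (μ + ν) x}) :
    tv μ ν = μ.real A - ν.real A := by
  have hc : μ.real Aᶜ - ν.real Aᶜ = -(μ.real A - ν.real A) := by
    rw [probReal_compl_eq_one_sub hA, probReal_compl_eq_one_sub hA]; ring
  have hiff : ∀ᵐ x ∂(μ + ν), (x ∈ A ↔
      (ν.rnDeriv (μ + ν) x).toReal ≤ (μ.rnDeriv (μ + ν) x).toReal) := by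
    filter_upwards [hAe.mem_iff, μ.rnDeriv_lt_top (μ + ν), ν.rnDeriv_lt_top (μ + ν)]
      with x h1 h2 h3
    rw [h1, ENNReal.toReal_le_toReal h3.ne h2.ne]
  have h1 : ∫ x in A, |(μ.rnDeriv (μ + ν) x).toReal - (ν.rnDeriv (μ + ν) x).toReal| ∂(μ + ν) =
      μ.real A - ν.real A := by
    rw [measureReal_sub_eq_setIntegral_rnDeriv]
    refine setIntegral_congr_ae hA ?_
    filter_upwards [hiff] with x hx hxA
    exact abs_of_nonneg (sub_nonneg.2 (hx.1 hxA))
  have h2 : ∫ x in Aᶜ, |(μ.rnDeriv (μ + ν) x).toReal - (ν.rnDeriv (μ + ν) x).toReal| ∂(μ + ν) =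
      μ.real A - ν.real A := by
    rw [← neg_eq_iff_eq_neg.2 hc, measureReal_sub_eq_setIntegral_rnDeriv, ← integral_neg]
    refine setIntegral_congr_ae hA.compl ?_
    filter_upwards [hiff] with x hx hxA
    have : ¬ _ := fun h => hxA (hx.2 h)
    exact abs_of_neg (sub_neg.2 (not_le.1 this))
  have h3 := integral_add_compl hA (integrable_rnDeriv_sub μ ν).abs
  unfold tv
  linarith

theorem tv_comm (μ ν : Measure Ω) : tv μ ν = tv ν μ := by
  unfold tv
  rw [add_comm ν μ]
  simp_rw [abs_sub_comm]

theorem tv_nonneg (μ ν : Measure Ω) : 0 ≤ tv μ ν :=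
  mul_nonneg (by norm_num) (integral_nonneg fun _ => abs_nonneg _)

/-- The left side is the gap on a single event, and that gap splits through `ρ`. -/
theorem tv_triangle (μ ρ ν : Measure Ω) [IsProbabilityMeasure μ] [IsProbabilityMeasure ρ]
    [IsProbabilityMeasure ν] : tv μ ν ≤ tv μ ρ + tv ρ ν := by
  have hA : MeasurableSet {x | μ.rnDeriv (μ + ν) x ≥ ν.rnDeriv (μ + ν) x} :=
    measurableSet_le (Measure.measurable_rnDeriv _ _) (Measure.measurable_rnDeriv _ _)
  rw [tv_eq_measureReal_sub μ ν hA Filter.EventuallyEq.rfl]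
  have h1 := (le_abs_self _).trans (abs_measureReal_sub_le_tv μ ρ hA)
  have h2 := (le_abs_self _).trans (abs_measureReal_sub_le_tv ρ ν hA)
  linarith

end TotalVariation

/-! ### The Yatracos pseudo-distance and the deterministic inequality. -/

section YatracosDistance

variable {Ω : Type*} [MeasurableSpace Ω] {N : ℕ}

/-- The probabilities of the sets of a Yatracos class, as a vector. -/
def yatracosVec (A : Fin N → Fin N → Set Ω) (μ : Measure Ω) :
    {p : Fin N × Fin N // p.1 ≠ p.2} → ℝ :=
  fun p => μ.real (A p.1.1 p.1.2)

/-- Symmetry, positivity and the triangle inequality are inherited from the sup metric. Without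
pairs `i ≠ j` both sides are `0`. -/
theorem yatracosDist_eq_dist (A : Fin N → Fin N → Set Ω) (μ ν : Measure Ω) :
    yatracosDist A μ ν = dist (yatracosVec A μ) (yatracosVec A ν) := by
  unfold yatracosDist
  have hle : ∀ r ∈ {r | ∃ i j, i ≠ j ∧ r = |μ.real (A i j) - ν.real (A i j)|},
      r ≤ dist (yatracosVec A μ) (yatracosVec A ν) := by
    rintro r ⟨i, j, hij, rfl⟩
    rw [← Real.dist_eq]
    exact dist_le_pi_dist (yatracosVec A μ) (yatracosVec A ν) ⟨(i, j), hij⟩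
  refine le_antisymm (Real.sSup_le hle dist_nonneg) ?_
  refine (dist_pi_le_iff (Real.sSup_nonneg ?_)).2 fun p => ?_
  · rintro r ⟨i, j, -, rfl⟩
    exact abs_nonneg _
  · rw [Real.dist_eq]
    exact le_csSup ⟨_, hle⟩ ⟨p.1.1, p.1.2, p.2, rfl⟩

theorem yatracosDist_le_iff {A : Fin N → Fin N → Set Ω} {μ ν : Measure Ω} {r : ℝ} (hr : 0 ≤ r) :
    yatracosDist A μ ν ≤ r ↔ ∀ i j, i ≠ j → |μ.real (A i j) - ν.real (A i j)| ≤ r := by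
  rw [yatracosDist_eq_dist, dist_pi_le_iff hr]
  exact ⟨fun h i j hij => h ⟨(i, j), hij⟩, fun h p => h _ _ p.2⟩

theorem le_yatracosDist (A : Fin N → Fin N → Set Ω) (μ ν : Measure Ω) {i j : Fin N} (h : i ≠ j) :
    |μ.real (A i j) - ν.real (A i j)| ≤ yatracosDist A μ ν :=
  (yatracosDist_le_iff (yatracosDist_eq_dist A μ ν ▸ dist_nonneg)).1 le_rfl i j h

theorem yatracosDist_nonneg (A : Fin N → Fin N → Set Ω) (μ ν : Measure Ω) :
    0 ≤ yatracosDist A μ ν :=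
  yatracosDist_eq_dist A μ ν ▸ dist_nonneg

theorem yatracosDist_comm (A : Fin N → Fin N → Set Ω) (μ ν : Measure Ω) :
    yatracosDist A μ ν = yatracosDist A ν μ := by
  rw [yatracosDist_eq_dist, yatracosDist_eq_dist, dist_comm]

theorem yatracosDist_triangle (A : Fin N → Fin N → Set Ω) (μ ρ ν : Measure Ω) :
    yatracosDist A μ ν ≤ yatracosDist A μ ρ + yatracosDist A ρ ν := by
  simp only [yatracosDist_eq_dist]
  exact dist_triangle _ _ _

theorem yatracosDist_le_tv {Q : Fin N → Measure Ω} {A : Fin N → Fin N → Set Ω}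
    (hA : IsYatracosClass Q A) (μ ν : Measure Ω) [IsProbabilityMeasure μ]
    [IsProbabilityMeasure ν] : yatracosDist A μ ν ≤ tv μ ν :=
  (yatracosDist_le_iff (tv_nonneg μ ν)).2 fun i j hij =>
    abs_measureReal_sub_le_tv μ ν (hA i j hij).1

theorem tv_le_yatracosDist {Q : Fin N → Measure Ω} {A : Fin N → Fin N → Set Ω}
    (hQ : ∀ i, IsProbabilityMeasure (Q i)) (hA : IsYatracosClass Q A) (i j : Fin N) :
    tv (Q i) (Q j) ≤ yatracosDist A (Q i) (Q j) := by
  have := hQ i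
  have := hQ j
  rcases eq_or_ne i j with rfl | hij
  · simp [tv, yatracosDist_nonneg]
  · rw [tv_eq_measureReal_sub (Q i) (Q j) (hA i j hij).1 (hA i j hij).2]
    exact (le_abs_self _).trans (le_yatracosDist A _ _ hij)

end YatracosDistance

theorem isProbabilityMeasure_of_mem_mixtureClass {d : ℕ} {M : ℝ}
    {P : Measure (EuclideanSpace ℝ (Fin d))} (hP : P ∈ mixtureClass d M) :
    IsProbabilityMeasure P := by
  obtain ⟨π, ⟨h, -⟩, rfl⟩ := hP
  exact isProbabilityMeasure_mixture π

/-- The deterministic inequality behind Yatracos' estimator. -/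
theorem tv_le_of_yatracosDist_le {d N : ℕ} {M η : ℝ}
    {Q : Fin N → Measure (EuclideanSpace ℝ (Fin d))}
    {A : Fin N → Fin N → Set (EuclideanSpace ℝ (Fin d))} (hQ : IsTVCover M η Q)
    (hA : IsYatracosClass Q A) {P P' E : Measure (EuclideanSpace ℝ (Fin d))}
    (hP : P ∈ mixtureClass d M) (hP' : P' ∈ mixtureClass d M)
    (h : yatracosDist A P' E ≤ yatracosDist A P E) :
    tv P P' ≤ 4 * η + 2 * yatracosDist A P E := by
  have := isProbabilityMeasure_of_mem_mixtureClass hP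
  have := isProbabilityMeasure_of_mem_mixtureClass hP'
  obtain ⟨i, hi⟩ := hQ.2 P hP
  obtain ⟨j, hj⟩ := hQ.2 P' hP'
  have := hQ.1 i
  have := hQ.1 j
  -- Each of the links `P`–`Q i` and `P'`–`Q j` costs `η` twice, once in `tv` and once in the
  -- pseudo-distance; `t3` is the only passage back to `tv`.
  have t1 := tv_triangle P (Q i) P'
  have t2 := tv_triangle (Q i) (Q j) P'
  have t3 := tv_le_yatracosDist hQ.1 hA i j
  have t4 := yatracosDist_triangle A (Q i) P (Q j)
  have t5 := yatracosDist_triangle A P E (Q j)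
  have t6 := yatracosDist_triangle A E P' (Q j)
  have t7 := yatracosDist_le_tv hA P (Q i)
  have t8 := yatracosDist_le_tv hA P' (Q j)
  rw [yatracosDist_comm A (Q i) P] at t4
  rw [yatracosDist_comm A E P'] at t6
  rw [tv_comm (Q j) P'] at t2
  linarith

/-! ### The chi-square type bound and the exponential kernel. -/

section ChiSquare

variable {d : ℕ} {M : ℝ}

theorem stdDensity_pos (x : EuclideanSpace ℝ (Fin d)) : 0 < stdDensity d x := by
  unfold stdDensity
  positivity

theorem integrable_stdDensity (d : ℕ) : Integrable (stdDensity d) := by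
  refine ⟨(continuous_stdDensity d).aestronglyMeasurable, ?_⟩
  rw [hasFiniteIntegral_iff_ofReal (ae_of_all _ stdDensity_nonneg), lintegral_stdDensity]
  exact ENNReal.one_lt_top

theorem integral_stdDensity (d : ℕ) : ∫ x, stdDensity d x = 1 := by
  rw [integral_eq_lintegral_of_nonneg_ae (ae_of_all _ stdDensity_nonneg)
    (continuous_stdDensity d).aestronglyMeasurable, lintegral_stdDensity, ENNReal.toReal_one]

/-- Completing the square. After division by `stdDensity d x` what remains is a shifted Gaussian of
mass one, so integrating over `x` leaves only the kernel. -/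
theorem stdDensity_sub_mul_stdDensity_sub (x θ θ' : EuclideanSpace ℝ (Fin d)) :
    stdDensity d (x - θ) * stdDensity d (x - θ') =
      Real.exp (inner ℝ θ θ') * stdDensity d (x - (θ + θ')) * stdDensity d x := by
  have h : Real.exp (-‖x - θ‖ ^ 2 / 2) * Real.exp (-‖x - θ'‖ ^ 2 / 2) =
      Real.exp (-‖x‖ ^ 2 / 2) * (Real.exp (inner ℝ θ θ') *
        Real.exp (-‖x - (θ + θ')‖ ^ 2 / 2)) := by
    rw [← Real.exp_add, ← Real.exp_add, ← Real.exp_add]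
    congr 1
    rw [@norm_sub_sq_real, @norm_sub_sq_real, @norm_sub_sq_real, @norm_add_sq_real, inner_add_right]
    ring
  unfold stdDensity
  linear_combination ((2 * Real.pi) ^ (-(d : ℝ) / 2)) ^ 2 * h

theorem GaussianMixture.IsMixing.ae_mem {π : Measure (EuclideanSpace ℝ (Fin d))} (h : IsMixing M π) :
    ∀ᵐ θ ∂π, θ ∈ cube d M := h.2

theorem abs_inner_le_of_mem_cube {θ θ' : EuclideanSpace ℝ (Fin d)} (h : θ ∈ cube d M)
    (h' : θ' ∈ cube d M) : |inner ℝ θ θ'| ≤ d * M ^ 2 := by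
  rw [PiLp.inner_apply]
  refine (Finset.abs_sum_le_sum_abs _ _).trans ?_
  calc ∑ i, |inner ℝ (θ i) (θ' i)| ≤ ∑ _i : Fin d, M ^ 2 := by
        refine Finset.sum_le_sum fun i _ => ?_
        rw [RCLike.inner_apply, conj_trivial, abs_mul, sq]
        exact mul_le_mul (h' i) (h i) (abs_nonneg _) ((abs_nonneg _).trans (h' i))
    _ = d * M ^ 2 := by simp

theorem ae_prod_mem_cube {π π' : Measure (EuclideanSpace ℝ (Fin d))} (h : IsMixing M π)
    (h' : IsMixing M π') : ∀ᵐ p ∂(π.prod π'), p.1 ∈ cube d M ∧ p.2 ∈ cube d M := by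
  have := h.1
  have := h'.1
  exact (Measure.quasiMeasurePreserving_fst.ae h.ae_mem).and
    (Measure.quasiMeasurePreserving_snd.ae h'.ae_mem)

theorem isCompact_cube (d : ℕ) (M : ℝ) : IsCompact (cube d M) := by
  have : cube d M = EuclideanSpace.equiv (Fin d) ℝ ⁻¹' Set.pi Set.univ fun _ => Set.Icc (-M) M := by
    ext θ
    exact ⟨fun h i _ => abs_le.1 (h i), fun h i => abs_le.2 (h i trivial)⟩
  rw [this]
  exact ((EuclideanSpace.equiv (Fin d) ℝ).toHomeomorph.isCompact_preimage).2
    (isCompact_univ_pi fun _ => isCompact_Icc)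

/-- Continuous functions are integrable with respect to products of mixing distributions. -/
theorem integrable_prod_of_continuous {π π' : Measure (EuclideanSpace ℝ (Fin d))}
    (h : IsMixing M π) (h' : IsMixing M π')
    {g : EuclideanSpace ℝ (Fin d) × EuclideanSpace ℝ (Fin d) → ℝ} (hg : Continuous g) :
    Integrable g (π.prod π') := by
  have := h.1
  have := h'.1
  obtain ⟨C, hC⟩ := ((isCompact_cube d M).prod (isCompact_cube d M)).exists_bound_of_continuousOn
    hg.continuousOn
  refine Integrable.of_bound hg.aestronglyMeasurable C ?_
  filter_upwards [ae_prod_mem_cube h h'] with p hp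
  exact hC p hp

theorem integrable_exp_inner {π π' : Measure (EuclideanSpace ℝ (Fin d))}
    (h : IsMixing M π) (h' : IsMixing M π') :
    Integrable (fun p : EuclideanSpace ℝ (Fin d) × EuclideanSpace ℝ (Fin d) =>
      Real.exp (inner ℝ p.1 p.2)) (π.prod π') :=
  integrable_prod_of_continuous h h' (by fun_prop)

theorem integrable_kernel {π π' : Measure (EuclideanSpace ℝ (Fin d))}
    (h : IsMixing M π) (h' : IsMixing M π') :
    Integrable (fun z : EuclideanSpace ℝ (Fin d) ×
      (EuclideanSpace ℝ (Fin d) × EuclideanSpace ℝ (Fin d)) =>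
      Real.exp (inner ℝ z.2.1 z.2.2) * stdDensity d (z.1 - (z.2.1 + z.2.2)))
      (volume.prod (π.prod π')) := by
  have := h.1
  have := h'.1
  have hc : Continuous (fun z : EuclideanSpace ℝ (Fin d) ×
      (EuclideanSpace ℝ (Fin d) × EuclideanSpace ℝ (Fin d)) =>
      Real.exp (inner ℝ z.2.1 z.2.2) * stdDensity d (z.1 - (z.2.1 + z.2.2))) :=
    (by fun_prop : Continuous _).mul ((continuous_stdDensity d).comp (by fun_prop))
  refine (integrable_prod_iff' hc.aestronglyMeasurable).2 ⟨ae_of_all _ fun p => ?_, ?_⟩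
  · exact ((integrable_stdDensity d).comp_sub_right (p.1 + p.2)).const_mul
      (Real.exp (inner ℝ p.1 p.2))
  · refine (integrable_exp_inner h h').congr (ae_of_all _ fun p => ?_)
    simp only
    rw [integral_congr_ae (ae_of_all _ fun x => Real.norm_of_nonneg
      (mul_nonneg (Real.exp_pos _).le (stdDensity_nonneg _))), integral_const_mul,
      integral_sub_right_eq_self (stdDensity d), integral_stdDensity, mul_one]

theorem mixtureDensity_mul_div (π π' : Measure (EuclideanSpace ℝ (Fin d)))
    [IsProbabilityMeasure π] [IsProbabilityMeasure π'] (x : EuclideanSpace ℝ (Fin d)) :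
    mixtureDensity π x * mixtureDensity π' x / stdDensity d x =
      ∫ p, Real.exp (inner ℝ p.1 p.2) * stdDensity d (x - (p.1 + p.2)) ∂(π.prod π') := by
  rw [div_eq_iff (stdDensity_pos x).ne', ← integral_mul_const]
  simp_rw [← stdDensity_sub_mul_stdDensity_sub]
  unfold mixtureDensity
  exact (integral_prod_mul _ _).symm

theorem integrable_mixtureDensity_mul_div {π π' : Measure (EuclideanSpace ℝ (Fin d))}
    (h : IsMixing M π) (h' : IsMixing M π') :
    Integrable fun x => mixtureDensity π x * mixtureDensity π' x / stdDensity d x := by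
  have := h.1
  have := h'.1
  simp_rw [mixtureDensity_mul_div]
  exact (integrable_kernel h h').integral_prod_left

theorem integral_mixtureDensity_mul_div {π π' : Measure (EuclideanSpace ℝ (Fin d))}
    (h : IsMixing M π) (h' : IsMixing M π') :
    ∫ x, mixtureDensity π x * mixtureDensity π' x / stdDensity d x =
      ∫ p, Real.exp (inner ℝ p.1 p.2) ∂(π.prod π') := by
  have := h.1
  have := h'.1
  simp_rw [mixtureDensity_mul_div]
  rw [integral_integral_swap (integrable_kernel h h')]
  simp_rw [integral_const_mul, integral_sub_right_eq_self (stdDensity d), integral_stdDensity,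
    mul_one]

/-- The total variation distance of two Gaussian mixtures is controlled by the exponential kernel
of their mixing distributions. -/
theorem tv_mixture_le {π π' : Measure (EuclideanSpace ℝ (Fin d))}
    (h : IsMixing M π) (h' : IsMixing M π') {c : ℝ} (hc : 0 < c)
    (hS : ∫ p, Real.exp (inner ℝ p.1 p.2) ∂(π.prod π)
      - 2 * ∫ p, Real.exp (inner ℝ p.1 p.2) ∂(π.prod π')
      + ∫ p, Real.exp (inner ℝ p.1 p.2) ∂(π'.prod π') ≤ (2 * c) ^ 2) :
    tv (mixture π) (mixture π') ≤ c := by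
  have := h.1
  have := h'.1
  rw [tv_mixture]
  have i1 := integrable_mixtureDensity_mul_div h h
  have i2 := (integrable_mixtureDensity_mul_div h h').const_mul 2
  have i3 := integrable_mixtureDensity_mul_div h' h'
  have i12 : Integrable fun x => mixtureDensity π x * mixtureDensity π x / stdDensity d x
      - 2 * (mixtureDensity π x * mixtureDensity π' x / stdDensity d x) := i1.sub i2
  have i123 : Integrable fun x => mixtureDensity π x * mixtureDensity π x / stdDensity d x
      - 2 * (mixtureDensity π x * mixtureDensity π' x / stdDensity d x)
      + mixtureDensity π' x * mixtureDensity π' x / stdDensity d x := i12.add i3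
  rw [← integral_mixtureDensity_mul_div h h, ← integral_mixtureDensity_mul_div h h',
    ← integral_mixtureDensity_mul_div h' h', ← integral_const_mul, ← integral_sub i1 i2,
    ← integral_add i12 i3] at hS
  -- Cauchy–Schwarz in pointwise form: `|u - v| ≤ c * p + (u - v)² / (4 * c * p)`, with `p` the
  -- Gaussian weight.
  have hmono : ∫ x, |mixtureDensity π x - mixtureDensity π' x| ≤
      ∫ x, (c * stdDensity d x + 1 / (4 * c) *
        (mixtureDensity π x * mixtureDensity π x / stdDensity d x
          - 2 * (mixtureDensity π x * mixtureDensity π' x / stdDensity d x)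
          + mixtureDensity π' x * mixtureDensity π' x / stdDensity d x)) := by
    refine integral_mono_of_nonneg (ae_of_all _ fun _ => abs_nonneg _)
      (((integrable_stdDensity d).const_mul c).add (i123.const_mul _))
      (ae_of_all _ fun x => ?_)
    beta_reduce
    have hp := stdDensity_pos x
    generalize stdDensity d x = p at hp
    generalize mixtureDensity π x = u
    generalize mixtureDensity π' x = v
    have e : c * p + 1 / (4 * c) * (u * u / p - 2 * (u * v / p) + v * v / p) =
        (4 * c ^ 2 * p ^ 2 + |u - v| ^ 2) / (4 * c * p) := by
      rw [sq_abs]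
      field_simp
      ring
    rw [e, le_div_iff₀ (by positivity)]
    nlinarith [sq_nonneg (2 * c * p - |u - v|)]
  rw [integral_add ((integrable_stdDensity d).const_mul c) (i123.const_mul _),
    integral_const_mul, integral_const_mul, integral_stdDensity] at hmono
  have h4 : 1 / (4 * c) * ∫ x, (mixtureDensity π x * mixtureDensity π x / stdDensity d x
          - 2 * (mixtureDensity π x * mixtureDensity π' x / stdDensity d x)
          + mixtureDensity π' x * mixtureDensity π' x / stdDensity d x) ≤
      1 / (4 * c) * (2 * c) ^ 2 := mul_le_mul_of_nonneg_left hS (by positivity)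
  have h5 : 1 / (4 * c) * (2 * c) ^ 2 = c := by
    field_simp
    ring
  linarith

end ChiSquare

/-! ### Existence of a measurable minimizer. -/

section Existence

variable {d : ℕ} {M : ℝ}

theorem isMixing_dirac {θ : EuclideanSpace ℝ (Fin d)} (h : θ ∈ cube d M) :
    IsMixing M (Measure.dirac θ) :=
  ⟨inferInstance, by rw [Measure.dirac_apply]; simp [h]⟩

theorem mem_cube_of_norm_le {θ : EuclideanSpace ℝ (Fin d)} (h : ‖θ‖ ≤ M) : θ ∈ cube d M :=
  fun i => (PiLp.norm_apply_le θ i).trans h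

theorem zero_mem_cube (hM : 0 ≤ M) : (0 : EuclideanSpace ℝ (Fin d)) ∈ cube d M :=
  mem_cube_of_norm_le (by simpa using hM)

/-- For two Dirac measures the kernel expression is continuous and vanishes on the diagonal, so
nearby locations are close in `tv`. -/
theorem continuous_mixture_dirac {A : Set (EuclideanSpace ℝ (Fin d))} (hA : MeasurableSet A) :
    Continuous fun θ => (mixture (Measure.dirac θ)).real A := by
  refine continuous_iff_continuousAt.2 fun θ => Metric.tendsto_nhds.2 fun ε hε => ?_
  have hcont : Continuous fun θ' : EuclideanSpace ℝ (Fin d) =>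
      Real.exp (inner ℝ θ' θ') - 2 * Real.exp (inner ℝ θ' θ) + Real.exp (inner ℝ θ θ) := by
    fun_prop
  have hlim := hcont.tendsto θ
  rw [show Real.exp (inner ℝ θ θ) - 2 * Real.exp (inner ℝ θ θ) + Real.exp (inner ℝ θ θ) = 0 by ring]
    at hlim
  filter_upwards [hlim.eventually_le_const (show 0 < (2 * (ε / 2)) ^ 2 by positivity)] with θ' h'
  have m1 : IsMixing (max ‖θ‖ ‖θ'‖) (Measure.dirac θ) :=
    isMixing_dirac (mem_cube_of_norm_le (le_max_left _ _))
  have m2 : IsMixing (max ‖θ‖ ‖θ'‖) (Measure.dirac θ') :=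
    isMixing_dirac (mem_cube_of_norm_le (le_max_right _ _))
  have htv : tv (mixture (Measure.dirac θ')) (mixture (Measure.dirac θ)) ≤ ε / 2 := by
    refine tv_mixture_le m2 m1 (half_pos hε) ?_
    simpa only [Measure.dirac_prod_dirac, integral_dirac] using h'
  have := isProbabilityMeasure_mixture (Measure.dirac θ)
  have := isProbabilityMeasure_mixture (Measure.dirac θ')
  rw [Real.dist_eq]
  linarith [abs_measureReal_sub_le_tv (mixture (Measure.dirac θ')) (mixture (Measure.dirac θ)) hA]

theorem mixture_apply (π : Measure (EuclideanSpace ℝ (Fin d))) [IsProbabilityMeasure π]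
    {A : Set (EuclideanSpace ℝ (Fin d))} (hA : MeasurableSet A) :
    mixture π A = ∫⁻ θ, mixture (Measure.dirac θ) A ∂π := by
  simp_rw [mixture, withDensity_apply _ hA, ofReal_mixtureDensity, lintegral_dirac]
  refine lintegral_lintegral_swap ?_
  exact (ENNReal.measurable_ofReal.comp
    ((continuous_stdDensity d).measurable.comp (measurable_fst.sub measurable_snd))).aemeasurable

/-- Exhibits the mass of a fixed event as the integral of a bounded continuous function, hence
weakly continuous in `π` even for irregular events. -/
theorem mixture_real_apply (π : Measure (EuclideanSpace ℝ (Fin d))) [IsProbabilityMeasure π]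
    {A : Set (EuclideanSpace ℝ (Fin d))} (hA : MeasurableSet A) :
    (mixture π).real A = ∫ θ, (mixture (Measure.dirac θ)).real A ∂π := by
  have hp : ∀ θ : EuclideanSpace ℝ (Fin d), IsProbabilityMeasure (mixture (Measure.dirac θ)) :=
    fun θ => isProbabilityMeasure_mixture _
  rw [measureReal_def, mixture_apply π hA,
    integral_eq_lintegral_of_nonneg_ae (ae_of_all _ fun θ => measureReal_nonneg)
      (continuous_mixture_dirac hA).aestronglyMeasurable]
  exact congrArg _ (lintegral_congr fun θ => (ofReal_measureReal (measure_ne_top _ _)).symm)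

theorem isCompact_image_yatracosVec {N : ℕ} {Q : Fin N → Measure (EuclideanSpace ℝ (Fin d))}
    {A : Fin N → Fin N → Set (EuclideanSpace ℝ (Fin d))} (hA : IsYatracosClass Q A) :
    IsCompact (yatracosVec A '' mixtureClass d M) := by
  -- Prokhorov with constant sequences: tolerance `0` outside the cube encodes exact support.
  have hK := isCompact_setOfPred_probabilityMeasure_mass_eq_compl_isCompact_le
    (u := fun _ => 0) (K := fun _ => cube d M) tendsto_const_nhds (fun _ => isCompact_cube d M)
    (Or.inl inferInstance)
  have hcont : Continuous fun π : ProbabilityMeasure (EuclideanSpace ℝ (Fin d)) =>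
      yatracosVec A (mixture (π : Measure (EuclideanSpace ℝ (Fin d)))) := by
    refine continuous_pi fun p => ?_
    have hm := (hA _ _ p.2).1
    have hb : ∀ θ : EuclideanSpace ℝ (Fin d),
        ‖(mixture (Measure.dirac θ)).real (A p.1.1 p.1.2)‖ ≤ 1 := fun θ => by
      have := isProbabilityMeasure_mixture (Measure.dirac θ)
      rw [Real.norm_of_nonneg measureReal_nonneg]
      exact measureReal_le_one
    have := ProbabilityMeasure.continuous_integral_boundedContinuousFunction
      (BoundedContinuousFunction.ofNormedAddCommGroup _ (continuous_mixture_dirac hm) 1 hb)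
    refine this.congr fun π => ?_
    exact (mixture_real_apply (π : Measure (EuclideanSpace ℝ (Fin d))) hm).symm
  convert hK.image hcont using 1
  ext v
  constructor
  · rintro ⟨_, ⟨π, ⟨h1, h2⟩, rfl⟩, rfl⟩
    let π' : ProbabilityMeasure (EuclideanSpace ℝ (Fin d)) := ⟨π, h1⟩
    refine ⟨π', fun _ => ?_, rfl⟩
    rw [← ENNReal.coe_le_coe, ProbabilityMeasure.ennreal_coeFn_eq_coeFn_toMeasure]
    exact h2.le
  · rintro ⟨π, hπ, rfl⟩
    refine ⟨_, ⟨π, ⟨inferInstance, ?_⟩, rfl⟩, rfl⟩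
    have := hπ 0
    rw [← ENNReal.coe_le_coe, ProbabilityMeasure.ennreal_coeFn_eq_coeFn_toMeasure] at this
    exact le_antisymm this bot_le

theorem exists_yatracosDist_minimizer {N : ℕ} {Q : Fin N → Measure (EuclideanSpace ℝ (Fin d))}
    {A : Fin N → Fin N → Set (EuclideanSpace ℝ (Fin d))} (hA : IsYatracosClass Q A) (hM : 0 ≤ M)
    (v : {p : Fin N × Fin N // p.1 ≠ p.2} → ℝ) :
    ∃ P ∈ mixtureClass d M, ∀ P' ∈ mixtureClass d M,
      dist (yatracosVec A P) v ≤ dist (yatracosVec A P') v := by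
  have hne : (yatracosVec A '' mixtureClass d M).Nonempty :=
    ⟨_, _, ⟨_, isMixing_dirac (zero_mem_cube hM), rfl⟩, rfl⟩
  obtain ⟨_, ⟨P, hP, rfl⟩, hmin⟩ := (isCompact_image_yatracosVec hA).exists_isMinOn hne
    (f := fun u => dist u v) (by fun_prop)
  exact ⟨P, hP, fun P' hP' => hmin ⟨P', hP', rfl⟩⟩

theorem empirical_real_apply {Ω : Type*} [MeasurableSpace Ω] {n : ℕ} (x : Fin n → Ω) {A : Set Ω}
    (hA : MeasurableSet A) :
    (empirical x).real A = (n : ℝ)⁻¹ * ∑ i, A.indicator (fun _ => (1 : ℝ)) (x i) := by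
  rw [measureReal_def, empirical, Measure.smul_apply, Measure.finsetSum_apply, smul_eq_mul,
    ENNReal.toReal_mul, ENNReal.toReal_inv, ENNReal.toReal_natCast, ENNReal.toReal_sum]
  · congr 1
    refine Finset.sum_congr rfl fun i _ => ?_
    rw [Measure.dirac_apply' _ hA]
    by_cases h : x i ∈ A <;> simp [h]
  · intro i _
    exact measure_ne_top _ _

/-- A Yatracos estimator exists: the distance to the empirical distribution attains its minimum,
and it only depends on the finitely many events `x i ∈ A j k`. -/
theorem exists_isYatracosEstimator {n N : ℕ} {Q : Fin N → Measure (EuclideanSpace ℝ (Fin d))}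
    {A : Fin N → Fin N → Set (EuclideanSpace ℝ (Fin d))} (hA : IsYatracosClass Q A) (hM : 0 ≤ M) :
    ∃ Phat : (Fin n → EuclideanSpace ℝ (Fin d)) → Measure (EuclideanSpace ℝ (Fin d)),
      IsYatracosEstimator M A Phat := by
  choose F hF hFmin using exists_yatracosDist_minimizer (M := M) hA hM
  let pattern : (Fin n → EuclideanSpace ℝ (Fin d)) →
      Fin n → {p : Fin N × Fin N // p.1 ≠ p.2} → Prop := fun x i p => x i ∈ A p.1.1 p.1.2
  let vec : (Fin n → {p : Fin N × Fin N // p.1 ≠ p.2} → Prop) →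
      {p : Fin N × Fin N // p.1 ≠ p.2} → ℝ :=
    fun s p => (n : ℝ)⁻¹ * ∑ i, {t : Prop | t}.indicator (fun _ => (1 : ℝ)) (s i p)
  have hvec : ∀ x, vec (pattern x) = yatracosVec A (empirical x) := by
    intro x
    funext p
    exact (empirical_real_apply x (hA _ _ p.2).1).symm
  have hpat : Measurable pattern := by
    refine measurable_pi_iff.2 fun i => measurable_pi_iff.2 fun p => ?_
    exact measurableSet_setOfPred.1 (measurable_pi_apply i (hA _ _ p.2).1)
  -- The pattern takes values in a finite type, so any choice `F` of minimizers composes to a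
  -- measurable map.
  refine ⟨fun x => F (vec (pattern x)), (measurable_of_countable (fun s => F (vec s))).comp hpat,
    fun x => ⟨hF _, fun P' hP' => ?_⟩⟩
  rw [yatracosDist_eq_dist, yatracosDist_eq_dist, ← hvec]
  exact hFmin _ P' hP'

end Existence

/-! ### Reduction to finitely many moments. -/

section Moments

variable {d : ℕ} {M : ℝ}

/-- For `k ≥ K` the factor `exp (k - K)` is at least one; inserting it in the tail terms and summing
over all `k` gives the bound. -/
theorem abs_exp_sub_sum_le (t : ℝ) (K : ℕ) :
    |Real.exp t - ∑ k ∈ Finset.range K, t ^ k / k.factorial| ≤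
      Real.exp (-K + Real.exp 1 * |t|) := by
  have hexp : ∀ s : ℝ, HasSum (fun k : ℕ => s ^ k / k.factorial) (Real.exp s) := fun s => by
    rw [Real.exp_eq_exp_ℝ]
    exact NormedSpace.expSeries_div_hasSum_exp s
  have hfin : HasSum (fun k : ℕ => if k ∈ Finset.range K then t ^ k / k.factorial else 0)
      (∑ k ∈ Finset.range K, t ^ k / k.factorial) := by
    have := hasSum_sum_of_ne_finset_zero (L := .unconditional ℕ) (s := Finset.range K)
      (f := fun k : ℕ => if k ∈ Finset.range K then t ^ k / k.factorial else 0)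
      (fun k hk => if_neg hk)
    rwa [Finset.sum_congr rfl fun k hk => if_pos hk] at this
  have hbound := (hexp (Real.exp 1 * |t|)).mul_left (Real.exp (-K))
  rw [← Real.exp_add] at hbound
  refine ((hexp t).sub hfin).norm_le_of_bounded hbound fun k => ?_
  split_ifs with hk
  · rw [sub_self, norm_zero]
    positivity
  · rw [sub_zero, norm_div, norm_pow, Real.norm_eq_abs, Real.norm_natCast, mul_pow, mul_div_assoc,
      ← mul_assoc, ← Real.exp_nat_mul, ← Real.exp_add]
    refine le_mul_of_one_le_left (by positivity) (Real.one_le_exp ?_)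
    have : (K : ℝ) ≤ k := by exact_mod_cast not_lt.1 fun h => hk (Finset.mem_range.2 h)
    linarith

/-- The moment `∫ θ^α dπ(θ)` of multi-index `α`. -/
noncomputable def mixingMoment (π : Measure (EuclideanSpace ℝ (Fin d))) (α : Fin d → ℕ) : ℝ :=
  ∫ θ, ∏ i, θ i ^ α i ∂π

theorem abs_mixingMoment_le {π : Measure (EuclideanSpace ℝ (Fin d))} (h : IsMixing M π)
    {α : Fin d → ℕ} {K : ℕ} (hα : ∀ i, α i ≤ K) : |mixingMoment π α| ≤ max 1 M ^ (d * K) := by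
  have := h.1
  have hb : ∀ᵐ θ ∂π, ‖∏ i, θ i ^ α i‖ ≤ max 1 M ^ (d * K) := by
    filter_upwards [h.ae_mem] with θ hθ
    rw [norm_prod]
    calc ∏ i, ‖θ i ^ α i‖ ≤ ∏ _i : Fin d, max 1 M ^ K := by
          refine Finset.prod_le_prod (fun _ _ => norm_nonneg _) fun i _ => ?_
          rw [norm_pow]
          exact (pow_le_pow_left₀ (norm_nonneg _) ((hθ i).trans (le_max_right _ _)) _).trans
            (pow_le_pow_right₀ (le_max_left _ _) (hα i))
      _ = max 1 M ^ (d * K) := by simp [← pow_mul, mul_comm]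
  simpa [mixingMoment] using norm_integral_le_of_norm_le_const hb

/-- The multinomial expansion separates the two variables, so Fubini factors each term. -/
theorem integral_inner_pow {π π' : Measure (EuclideanSpace ℝ (Fin d))}
    (h : IsMixing M π) (h' : IsMixing M π') (k : ℕ) :
    ∫ p, inner ℝ p.1 p.2 ^ k ∂(π.prod π') =
      ∑ α ∈ Finset.piAntidiag Finset.univ k, (Nat.multinomial Finset.univ α : ℝ) *
        (mixingMoment π α * mixingMoment π' α) := by
  have := h.1
  have := h'.1
  have hpow : ∀ p : EuclideanSpace ℝ (Fin d) × EuclideanSpace ℝ (Fin d),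
      (inner ℝ p.1 p.2 : ℝ) ^ k = ∑ α ∈ Finset.piAntidiag Finset.univ k,
        (Nat.multinomial Finset.univ α : ℝ) * ((∏ i, p.1 i ^ α i) * ∏ i, p.2 i ^ α i) := fun p => by
    rw [PiLp.inner_apply, Finset.sum_pow_eq_sum_piAntidiag]
    refine Finset.sum_congr rfl fun α _ => ?_
    rw [← Finset.prod_mul_distrib]
    congr 1
    refine Finset.prod_congr rfl fun i _ => ?_
    rw [RCLike.inner_apply, conj_trivial, mul_pow, mul_comm]
  simp_rw [hpow]
  rw [integral_finsetSum]
  · refine Finset.sum_congr rfl fun α _ => ?_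
    rw [integral_const_mul]
    congr 1
    exact integral_prod_mul (fun θ : EuclideanSpace ℝ (Fin d) => ∏ i, θ i ^ α i)
      (fun θ : EuclideanSpace ℝ (Fin d) => ∏ i, θ i ^ α i)
  · intro α _
    exact integrable_prod_of_continuous h h' (by fun_prop)

theorem abs_integral_exp_inner_sub_le {π π' : Measure (EuclideanSpace ℝ (Fin d))}
    (h : IsMixing M π) (h' : IsMixing M π') (K : ℕ) :
    |∫ p, Real.exp (inner ℝ p.1 p.2) ∂(π.prod π') -
      ∑ k ∈ Finset.range K, (∑ α ∈ Finset.piAntidiag Finset.univ k,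
        (Nat.multinomial Finset.univ α : ℝ) * (mixingMoment π α * mixingMoment π' α)) /
          k.factorial| ≤ Real.exp (-K + Real.exp 1 * (d * M ^ 2)) := by
  have := h.1
  have := h'.1
  simp_rw [← integral_inner_pow h h', ← integral_div]
  have hi : ∀ k ∈ Finset.range K, Integrable (fun p : EuclideanSpace ℝ (Fin d) ×
      EuclideanSpace ℝ (Fin d) => (inner ℝ p.1 p.2 : ℝ) ^ k / k.factorial) (π.prod π') :=
    fun k _ => integrable_prod_of_continuous h h' (by fun_prop)
  rw [← integral_finsetSum _ hi, ← integral_sub (integrable_exp_inner h h')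
    (integrable_finsetSum _ hi)]
  have hb : ∀ᵐ p ∂(π.prod π'), ‖Real.exp (inner ℝ p.1 p.2) -
      ∑ k ∈ Finset.range K, (inner ℝ p.1 p.2 : ℝ) ^ k / k.factorial‖ ≤
      Real.exp (-K + Real.exp 1 * (d * M ^ 2)) := by
    filter_upwards [ae_prod_mem_cube h h'] with p hp
    refine (abs_exp_sub_sum_le _ K).trans (Real.exp_le_exp.2 ?_)
    gcongr
    exact abs_inner_le_of_mem_cube hp.1 hp.2
  simpa using norm_integral_le_of_norm_le_const hb

/-- The multinomial coefficients of degree `k` sum to `d ^ k`; the total weight of the moment errors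
is thus bounded independently of `K`. -/
theorem sum_multinomial_div_factorial_le (d K : ℕ) :
    ∑ k ∈ Finset.range K, (∑ α ∈ Finset.piAntidiag (Finset.univ : Finset (Fin d)) k,
      (Nat.multinomial Finset.univ α : ℝ)) / k.factorial ≤ Real.exp d := by
  have hd : ∀ k, ∑ α ∈ Finset.piAntidiag (Finset.univ : Finset (Fin d)) k,
      (Nat.multinomial Finset.univ α : ℝ) = (d : ℝ) ^ k := fun k => by
    have := Finset.sum_pow_eq_sum_piAntidiag (Finset.univ : Finset (Fin d)) (fun _ => (1 : ℝ)) k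
    simpa using this.symm
  simp_rw [hd]
  exact Real.sum_le_exp_of_nonneg (Nat.cast_nonneg d) K

/-- Mixing distributions whose moments are close have close Gaussian mixtures. -/
theorem tv_mixture_le_of_moments {π π' : Measure (EuclideanSpace ℝ (Fin d))}
    (h : IsMixing M π) (h' : IsMixing M π') {K : ℕ} {δ c : ℝ}
    (hδ : ∀ α : Fin d → ℕ, (∀ i, α i < K) → |mixingMoment π α - mixingMoment π' α| ≤ δ)
    (hc : 0 < c)
    (hKc : δ ^ 2 * Real.exp d + 4 * Real.exp (-K + Real.exp 1 * (d * M ^ 2)) ≤ (2 * c) ^ 2) :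
    tv (mixture π) (mixture π') ≤ c := by
  refine tv_mixture_le h h' hc (le_trans ?_ hKc)
  -- The kernel integrals have coefficients `1, -2, 1`, so the truncation errors total four.
  have e1 := (abs_sub_le_iff.1 (abs_integral_exp_inner_sub_le h h K)).1
  have e2 := (abs_sub_le_iff.1 (abs_integral_exp_inner_sub_le h h' K)).2
  have e3 := (abs_sub_le_iff.1 (abs_integral_exp_inner_sub_le h' h' K)).1
  -- The truncated sums combine termwise into squares of moment differences.
  have hsum : ∑ k ∈ Finset.range K, (∑ α ∈ Finset.piAntidiag Finset.univ k,
        (Nat.multinomial Finset.univ α : ℝ) * (mixingMoment π α * mixingMoment π α)) / k.factorial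
      - 2 * ∑ k ∈ Finset.range K, (∑ α ∈ Finset.piAntidiag Finset.univ k,
        (Nat.multinomial Finset.univ α : ℝ) * (mixingMoment π α * mixingMoment π' α)) / k.factorial
      + ∑ k ∈ Finset.range K, (∑ α ∈ Finset.piAntidiag Finset.univ k,
        (Nat.multinomial Finset.univ α : ℝ) * (mixingMoment π' α * mixingMoment π' α)) / k.factorial
      ≤ δ ^ 2 * Real.exp d := by
    refine le_trans ?_ (mul_le_mul_of_nonneg_left (sum_multinomial_div_factorial_le d K)
      (sq_nonneg δ))
    simp_rw [Finset.mul_sum, Finset.sum_div, Finset.mul_sum]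
    simp only [← Finset.sum_sub_distrib, ← Finset.sum_add_distrib]
    refine Finset.sum_le_sum fun k hk => Finset.sum_le_sum fun α hα => ?_
    have hαK : ∀ i, α i < K := fun i =>
      ((Finset.single_le_sum (fun _ _ => Nat.zero_le _) (Finset.mem_univ i)).trans_eq
        (Finset.mem_piAntidiag.1 hα).1).trans_lt (Finset.mem_range.1 hk)
    have hsq : (mixingMoment π α - mixingMoment π' α) ^ 2 ≤ δ ^ 2 :=
      sq_le_sq.2 ((hδ α hαK).trans (le_abs_self δ))
    have hm : (0 : ℝ) ≤ (Nat.multinomial Finset.univ α : ℝ) / k.factorial := by positivity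
    calc _ = (mixingMoment π α - mixingMoment π' α) ^ 2 *
          ((Nat.multinomial Finset.univ α : ℝ) / k.factorial) := by ring
      _ ≤ _ := mul_le_mul_of_nonneg_right hsq hm
  linarith

end Moments

/-! ### A proper covering from rounded moments. -/

section Covering

variable {d : ℕ} {M : ℝ}

/-- The class of Gaussian mixtures has a proper covering indexed by cells of moment vectors. -/
theorem exists_proper_isTVCover (hM : 0 ≤ M) {K L : ℕ} {δ η : ℝ} (hδ : 0 < δ) (hη : 0 < η)
    (hK : δ ^ 2 * Real.exp d + 4 * Real.exp (-K + Real.exp 1 * (d * M ^ 2)) ≤ (2 * η) ^ 2)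
    (hL : max 1 M ^ (d * K) ≤ L * δ) :
    ∃ Q : Fin ((2 * L + 1) ^ (K ^ d)) → Measure (EuclideanSpace ℝ (Fin d)),
      IsTVCover M η Q ∧ ∀ i, Q i ∈ mixtureClass d M := by
  classical
  have hcard : Fintype.card ((Fin d → Fin K) → Finset.Icc (-L : ℤ) L) =
      (2 * L + 1) ^ (K ^ d) := by
    simp only [Fintype.card_pi, Finset.prod_const, Finset.card_univ, Fintype.card_fin,
      Fintype.card_coe, Int.card_Icc]
    congr 1
    omega
  let e := Fintype.equivFinOfCardEq hcard
  have hcell : ∀ s : (Fin d → Fin K) → Finset.Icc (-L : ℤ) L,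
      ∃ π : Measure (EuclideanSpace ℝ (Fin d)), IsMixing M π ∧
        ((∃ π', IsMixing M π' ∧ ∀ α, (s α : ℤ) = ⌊mixingMoment π' (fun i => α i) / δ⌋) →
          ∀ α, (s α : ℤ) = ⌊mixingMoment π (fun i => α i) / δ⌋) := fun s => by
    by_cases hs : ∃ π', IsMixing M π' ∧ ∀ α, (s α : ℤ) = ⌊mixingMoment π' (fun i => α i) / δ⌋
    · obtain ⟨π, h1, h2⟩ := hs
      exact ⟨π, h1, fun _ => h2⟩
    · exact ⟨_, isMixing_dirac (zero_mem_cube hM), fun h => absurd h hs⟩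
  choose ρ hρ hρs using hcell
  refine ⟨fun i => mixture (ρ (e.symm i)), ⟨fun i => ?_, ?_⟩, fun i => ⟨_, hρ _, rfl⟩⟩
  · have := (hρ (e.symm i)).1
    exact isProbabilityMeasure_mixture _
  · rintro _ ⟨π, hπ, rfl⟩
    have hmem : ∀ α : Fin d → Fin K,
        ⌊mixingMoment π (fun i => α i) / δ⌋ ∈ Finset.Icc (-L : ℤ) L := fun α => by
      have hb := abs_le.1 ((abs_mixingMoment_le hπ (K := K) (fun i => (α i).2.le)).trans hL)
      rw [Finset.mem_Icc, Int.le_floor]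
      constructor
      · rw [le_div_iff₀ hδ]
        push_cast
        linarith
      · rw [← Int.cast_le (R := ℝ)]
        refine (Int.floor_le _).trans ((div_le_iff₀ hδ).2 ?_)
        push_cast
        exact hb.2
    let s : (Fin d → Fin K) → Finset.Icc (-L : ℤ) L := fun α => ⟨_, hmem α⟩
    refine ⟨e s, ?_⟩
    beta_reduce
    rw [e.symm_apply_apply]
    refine tv_mixture_le_of_moments hπ (hρ s) (K := K) (δ := δ) (fun α hα => ?_) hη hK
    have hfl : ⌊mixingMoment π α / δ⌋ = ⌊mixingMoment (ρ s) α / δ⌋ :=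
      hρs s ⟨π, hπ, fun _ => rfl⟩ fun i => ⟨α i, hα i⟩
    have := Int.abs_sub_lt_one_of_floor_eq_floor hfl
    rw [← sub_div, abs_div, abs_of_pos hδ, div_lt_one hδ] at this
    exact this.le

end Covering

/-! ### Metric entropy at the resolution of the estimator. -/

section CoveringNumber

variable {d : ℕ} {M : ℝ}

theorem sq_rpow_half_div_sqrt {ℓ : ℝ} (hℓ : 0 ≤ ℓ) (d n : ℕ) :
    (ℓ ^ ((d : ℝ) / 2) / √(n : ℝ)) ^ 2 = ℓ ^ d / n := by
  rw [div_pow, Real.sq_sqrt (Nat.cast_nonneg n), ← Real.rpow_natCast (ℓ ^ _), ← Real.rpow_mul hℓ]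
  norm_num

/-- The metric entropy of Gaussian mixtures at the resolution `log^{d/2}(n) / √n` is of order
`log^{d+1}(n)`. -/
theorem exists_properCoveringNumber_le (d : ℕ) {M : ℝ} (hM : 0 ≤ M) {a : ℝ} (ha : 0 < a) :
    ∃ C : ℝ, 0 < C ∧ ∀ (n : ℕ) (η : ℝ), 2 ≤ n →
      a * (Real.log n ^ ((d : ℝ) / 2) / √(n : ℝ)) ≤ η →
      (∃ Q : Fin (properCoveringNumber d M η) → Measure (EuclideanSpace ℝ (Fin d)),
        IsTVCover M η Q ∧ ∀ i, Q i ∈ mixtureClass d M) ∧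
      (properCoveringNumber d M η : ℝ) ≤ Real.exp (C * Real.log n ^ (d + 1)) := by
  have hl2 : 0 < Real.log 2 := Real.log_pos one_lt_two
  set κ : ℝ := a ^ 2 * Real.log 2 ^ d with hκ
  have hκ0 : 0 < κ := by positivity
  -- Since `η ^ 2 ≥ κ / n`, the error budget `(2 * η) ^ 2` is split in halves `2 * κ / n`: `c₁` fits
  -- the rounding error, `c₂` the truncation error.
  obtain ⟨c₁, hc₁, hc₁'⟩ : ∃ c₁ : ℝ, 0 ≤ c₁ ∧ d - Real.log (2 * κ) ≤ 2 * c₁ :=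
    ⟨max 0 ((d - Real.log (2 * κ)) / 2), le_max_left _ _, by
      linarith [le_max_right 0 ((d - Real.log (2 * κ)) / 2)]⟩
  obtain ⟨c₂, hc₂, hc₂'⟩ : ∃ c₂ : ℝ, 0 ≤ c₂ ∧
      Real.exp 1 * (d * M ^ 2) + Real.log 4 - Real.log (2 * κ) ≤ c₂ :=
    ⟨max 0 _, le_max_left _ _, le_max_right _ _⟩
  set β : ℝ := Real.log (max 1 M) with hβ
  have hβ0 : 0 ≤ β := Real.log_nonneg (le_max_left _ _)
  -- As `ℓ ≥ log 2`, dividing by `log 2` lets additive constants be absorbed into multiples of `ℓ`.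
  set c₃ : ℝ := 1 + (c₂ + 1) / Real.log 2 with hc₃
  set c₄ : ℝ := d * β * c₃ + 1 + (4 + c₁) / Real.log 2 with hc₄
  have hc₃0 : 0 < c₃ := by positivity
  have hc₄0 : 0 < c₄ := by positivity
  refine ⟨c₃ ^ d * c₄, by positivity, fun n η hn hη => ?_⟩
  have hn0 : (0 : ℝ) < n := by positivity
  have hℓ2 : Real.log 2 ≤ Real.log n := Real.log_le_log two_pos (by exact_mod_cast hn)
  have hexpℓ : Real.exp (Real.log n) = n := Real.exp_log hn0
  set ℓ := Real.log n with hℓ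
  have hℓ0 : 0 < ℓ := hl2.trans_le hℓ2
  have hη0 : 0 < η := lt_of_lt_of_le (by positivity) hη
  have hηsq : κ / n ≤ η ^ 2 := by
    calc κ / n ≤ a ^ 2 * (ℓ ^ d / n) := by
          rw [hκ, mul_div_assoc]
          gcongr
      _ = (a * (ℓ ^ ((d : ℝ) / 2) / √(n : ℝ))) ^ 2 := by
          rw [mul_pow, sq_rpow_half_div_sqrt hℓ0.le]
      _ ≤ η ^ 2 := by gcongr
  have hbd : ∀ u : ℝ, u ≤ Real.log (2 * κ) - ℓ → Real.exp u ≤ 2 * κ / n := fun u hu => by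
    refine (Real.exp_le_exp.2 hu).trans_eq ?_
    rw [Real.exp_sub, Real.exp_log (by positivity), hexpℓ]
  set K : ℕ := ⌈ℓ + c₂⌉₊ with hKdef
  have hK1 : ℓ + c₂ ≤ K := Nat.le_ceil _
  have hK2 : (K : ℝ) ≤ c₃ * ℓ := by
    have h1 : (K : ℝ) < ℓ + c₂ + 1 := Nat.ceil_lt_add_one (by positivity)
    have h2 : c₂ + 1 ≤ (c₂ + 1) / Real.log 2 * ℓ := by
      rw [div_mul_eq_mul_div, le_div_iff₀ hl2]
      gcongr
    rw [hc₃, add_mul]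
    linarith
  set δ : ℝ := Real.exp (-(c₁ + ℓ)) with hδdef
  have hδ : 0 < δ := Real.exp_pos _
  set L : ℕ := ⌈max 1 M ^ (d * K) / δ⌉₊ with hLdef
  have hcov := exists_proper_isTVCover (d := d) hM (K := K) (L := L) hδ hη0 (by
    have h1 : δ ^ 2 * Real.exp d ≤ 2 * κ / n := by
      rw [hδdef, ← Real.exp_nat_mul, ← Real.exp_add]
      refine hbd _ ?_
      push_cast
      linarith
    have h2 : 4 * Real.exp (-K + Real.exp 1 * (d * M ^ 2)) ≤ 2 * κ / n := by
      rw [← Real.exp_log (show (0 : ℝ) < 4 by norm_num), ← Real.exp_add]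
      exact hbd _ (by linarith)
    have h3 : 2 * κ / n = 2 * (κ / n) := by ring
    nlinarith) ((div_le_iff₀ hδ).1 (Nat.le_ceil _))
  -- Nonemptiness is essential: `sInf ∅ = 0` in `ℕ` would not be the size of a cover.
  refine ⟨Nat.sInf_mem (s := {N | ∃ Q : Fin N → Measure (EuclideanSpace ℝ (Fin d)),
    IsTVCover M η Q ∧ ∀ i, Q i ∈ mixtureClass d M}) ⟨_, hcov⟩, ?_⟩
  have hle : properCoveringNumber d M η ≤ (2 * L + 1) ^ (K ^ d) := Nat.sInf_le hcov
  have hB : max 1 M ^ (d * K) / δ = Real.exp (d * K * β + c₁ + ℓ) := by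
    rw [hδdef, Real.exp_neg, div_inv_eq_mul, hβ, add_assoc, Real.exp_add (d * K * _), mul_comm _
      (Real.log _), Real.exp_mul, Real.exp_log (by positivity)]
    norm_cast
  have hL : (2 * L + 1 : ℝ) ≤ Real.exp (c₄ * ℓ) := by
    have h1 : (L : ℝ) < max 1 M ^ (d * K) / δ + 1 := Nat.ceil_lt_add_one (by positivity)
    rw [hB] at h1
    have h2 : 1 ≤ Real.exp (d * K * β + c₁ + ℓ) := Real.one_le_exp (by positivity)
    have h3 : (5 : ℝ) ≤ Real.exp 4 := by
      have := Real.add_one_le_exp (4 : ℝ)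
      linarith
    calc (2 * L + 1 : ℝ) ≤ 5 * Real.exp (d * K * β + c₁ + ℓ) := by linarith
      _ ≤ Real.exp 4 * Real.exp (d * K * β + c₁ + ℓ) := by gcongr
      _ ≤ Real.exp (c₄ * ℓ) := by
          rw [← Real.exp_add, Real.exp_le_exp]
          have h4 : 4 + c₁ ≤ (4 + c₁) / Real.log 2 * ℓ := by
            rw [div_mul_eq_mul_div, le_div_iff₀ hl2]
            gcongr
          have h5 : d * K * β ≤ d * (c₃ * ℓ) * β := by gcongr
          rw [hc₄]
          linarith
  calc (properCoveringNumber d M η : ℝ) ≤ (2 * L + 1) ^ (K ^ d) := by exact_mod_cast hle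
    _ ≤ Real.exp (c₄ * ℓ) ^ (K ^ d) := by gcongr
    _ = Real.exp (K ^ d * (c₄ * ℓ)) := by rw [← Real.exp_nat_mul]; push_cast; rfl
    _ ≤ Real.exp ((c₃ * ℓ) ^ d * (c₄ * ℓ)) := by gcongr
    _ = Real.exp (c₃ ^ d * c₄ * ℓ ^ (d + 1)) := by ring_nf

end CoveringNumber

/-! ### Hoeffding's inequality and the union bound. -/

section Concentration

open ProbabilityTheory

variable {Ω : Type*} [MeasurableSpace Ω]

/-- Hoeffding's inequality for the empirical frequency of an event. -/
theorem measureReal_empirical_sub_ge_le (μ : Measure Ω) [IsProbabilityMeasure μ] {A : Set Ω}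
    (hA : MeasurableSet A) {n : ℕ} (hn : 0 < n) {t : ℝ} (ht : 0 ≤ t) :
    (Measure.pi fun _ : Fin n => μ).real {x | t ≤ (empirical x).real A - μ.real A} ≤
      Real.exp (-2 * n * t ^ 2) := by
  have hn' : (0 : ℝ) < n := by exact_mod_cast hn
  have hm : Measurable (A.indicator fun _ => (1 : ℝ)) := measurable_const.indicator hA
  have hint : μ[A.indicator fun _ => (1 : ℝ)] = μ.real A := by
    rw [integral_indicator_const _ hA, smul_eq_mul, mul_one]
  -- An indicator has range of length one, hence variance proxy `1 / 4` and exponent `-2 * n * t ^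
  -- 2`.
  have hsub : HasSubgaussianMGF (fun ω => A.indicator (fun _ => (1 : ℝ)) ω - μ.real A)
      ((‖(1 : ℝ) - 0‖₊ / 2) ^ 2) μ := by
    rw [← hint]
    refine hasSubgaussianMGF_of_mem_Icc hm.aemeasurable (ae_of_all _ fun ω => ?_)
    by_cases h : ω ∈ A <;> simp [h]
  have hind : iIndepFun (fun (i : Fin n) (x : Fin n → Ω) =>
      A.indicator (fun _ => (1 : ℝ)) (x i) - μ.real A) (Measure.pi fun _ : Fin n => μ) :=
    iIndepFun_pi (μ := fun _ : Fin n => μ)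
      (X := fun (_ : Fin n) ω => A.indicator (fun _ => (1 : ℝ)) ω - μ.real A)
      fun _ => (hm.sub_const _).aemeasurable
  have hsubi : ∀ i ∈ (Finset.univ : Finset (Fin n)), HasSubgaussianMGF (fun x : Fin n → Ω =>
      A.indicator (fun _ => (1 : ℝ)) (x i) - μ.real A) ((‖(1 : ℝ) - 0‖₊ / 2) ^ 2)
      (Measure.pi fun _ : Fin n => μ) := fun i _ => by
    refine HasSubgaussianMGF.of_map (X := fun ω => A.indicator (fun _ => (1 : ℝ)) ω - μ.real A)
      (measurable_pi_apply i).aemeasurable ?_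
    rwa [(measurePreserving_eval (fun _ : Fin n => μ) i).map_eq]
  have key := HasSubgaussianMGF.measure_sum_ge_le_of_iIndepFun hind hsubi
    (ε := n * t) (by positivity)
  have hset : {x : Fin n → Ω | t ≤ (empirical x).real A - μ.real A} =
      {x | n * t ≤ ∑ i, (A.indicator (fun _ => (1 : ℝ)) (x i) - μ.real A)} := by
    ext x
    rw [Set.mem_ofPred_eq, Set.mem_ofPred_eq, empirical_real_apply x hA, Finset.sum_sub_distrib,
      Finset.sum_const, Finset.card_univ, Fintype.card_fin, nsmul_eq_mul,
      ← mul_le_mul_iff_right₀ hn', mul_sub, mul_inv_cancel_left₀ hn'.ne']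
  rw [hset]
  refine key.trans_eq (congrArg Real.exp ?_)
  simp
  field_simp

theorem isProbabilityMeasure_empirical {n : ℕ} (hn : 0 < n) (x : Fin n → Ω) :
    IsProbabilityMeasure (empirical x) := ⟨by
  have : (n : ℝ≥0∞) ≠ 0 := by exact_mod_cast hn.ne'
  simp [empirical, ENNReal.inv_mul_cancel this]⟩

/-- A downward deviation on `A` is an upward deviation on `Aᶜ`. -/
theorem measureReal_abs_sub_empirical_ge_le (μ : Measure Ω) [IsProbabilityMeasure μ] {A : Set Ω}
    (hA : MeasurableSet A) {n : ℕ} (hn : 0 < n) {t : ℝ} (ht : 0 ≤ t) :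
    (Measure.pi fun _ : Fin n => μ).real {x | t ≤ |μ.real A - (empirical x).real A|} ≤
      2 * Real.exp (-2 * n * t ^ 2) := by
  have hemp : ∀ x : Fin n → Ω, IsProbabilityMeasure (empirical x) :=
    isProbabilityMeasure_empirical hn
  have h1 := measureReal_empirical_sub_ge_le μ hA hn ht
  have h2 := measureReal_empirical_sub_ge_le μ hA.compl hn ht
  have hsub : {x : Fin n → Ω | t ≤ |μ.real A - (empirical x).real A|} ⊆
      {x | t ≤ (empirical x).real A - μ.real A} ∪ {x | t ≤ (empirical x).real Aᶜ - μ.real Aᶜ} := by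
    intro x hx
    rw [Set.mem_ofPred_eq] at hx
    rcases le_abs.1 hx with h | h
    · right
      rw [Set.mem_ofPred_eq, probReal_compl_eq_one_sub hA, probReal_compl_eq_one_sub hA]
      linarith
    · left
      rw [Set.mem_ofPred_eq]
      linarith
  have h3 := (measureReal_mono hsub).trans (measureReal_union_le
    (μ := Measure.pi fun _ : Fin n => μ) _ _)
  linarith

/-- Uniform deviations over a Yatracos class. -/
theorem measureReal_lt_yatracosDist_empirical_le {N : ℕ} {Q : Fin N → Measure Ω}
    {A : Fin N → Fin N → Set Ω} (hA : IsYatracosClass Q A) (μ : Measure Ω)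
    [IsProbabilityMeasure μ] {n : ℕ} (hn : 0 < n) {t : ℝ} (ht : 0 ≤ t) :
    (Measure.pi fun _ : Fin n => μ).real {x | t < yatracosDist A μ (empirical x)} ≤
      N ^ 2 * (2 * Real.exp (-2 * n * t ^ 2)) := by
  have hsub : {x : Fin n → Ω | t < yatracosDist A μ (empirical x)} ⊆
      ⋃ p ∈ (Finset.univ : Finset (Fin N × Fin N)).filter (fun p => p.1 ≠ p.2),
        {x | t ≤ |μ.real (A p.1 p.2) - (empirical x).real (A p.1 p.2)|} := by
    intro x hx
    have hx' := mt (yatracosDist_le_iff ht).2 (not_le.2 hx)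
    push Not at hx'
    obtain ⟨i, j, hij, h⟩ := hx'
    simp only [Set.mem_iUnion]
    exact ⟨(i, j), by simpa using hij, h.le⟩
  refine (measureReal_mono hsub (measure_ne_top _ _)).trans ((measureReal_biUnion_finset_le _ _).trans ?_)
  refine (Finset.sum_le_card_nsmul _ _ _ fun p hp =>
    measureReal_abs_sub_empirical_ge_le μ (hA _ _ (Finset.mem_filter.1 hp).2).1 hn ht).trans ?_
  rw [nsmul_eq_mul]
  refine mul_le_mul_of_nonneg_right ?_ (by positivity)
  have := Finset.card_filter_le (Finset.univ : Finset (Fin N × Fin N)) fun p => p.1 ≠ p.2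
  rw [Finset.card_univ, Fintype.card_prod, Fintype.card_fin, ← sq] at this
  exact_mod_cast this

end Concentration

/-! ### Contamination and the risk bound. -/

section Risk

variable {d : ℕ} {M : ℝ}

theorem isProbabilityMeasure_huber {ε : ℝ} (h0 : 0 ≤ ε) (h1 : ε ≤ 1)
    (π R : Measure (EuclideanSpace ℝ (Fin d))) [IsProbabilityMeasure π] [IsProbabilityMeasure R] :
    IsProbabilityMeasure (huber ε π R) := by
  have := isProbabilityMeasure_mixture π
  refine ⟨?_⟩
  rw [huber, Measure.add_apply, Measure.smul_apply, Measure.smul_apply, measure_univ, measure_univ,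
    smul_eq_mul, smul_eq_mul, mul_one, mul_one, ← ENNReal.ofReal_add (sub_nonneg.2 h1) h0,
    sub_add_cancel, ENNReal.ofReal_one]

/-- On every set the difference is `ε` times a difference of two probabilities. -/
theorem yatracosDist_mixture_huber_le {N : ℕ} (A : Fin N → Fin N → Set (EuclideanSpace ℝ (Fin d)))
    {ε : ℝ} (h0 : 0 ≤ ε) (h1 : ε ≤ 1) (π R : Measure (EuclideanSpace ℝ (Fin d)))
    [IsProbabilityMeasure π] [IsProbabilityMeasure R] :
    yatracosDist A (mixture π) (huber ε π R) ≤ ε := by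
  have := isProbabilityMeasure_mixture π
  refine (yatracosDist_le_iff h0).2 fun i j _ => ?_
  have hreal : (huber ε π R).real (A i j) =
      (1 - ε) * (mixture π).real (A i j) + ε * R.real (A i j) := by
    have hne : ∀ (c : ℝ) (μ : Measure (EuclideanSpace ℝ (Fin d))) [IsProbabilityMeasure μ],
        (ENNReal.ofReal c • μ) (A i j) ≠ ∞ := fun c μ _ =>
      ENNReal.mul_ne_top ENNReal.ofReal_ne_top (measure_ne_top _ _)
    rw [huber, measureReal_add_apply (hne _ _) (hne _ _), measureReal_ennreal_smul_apply,
      measureReal_ennreal_smul_apply, ENNReal.toReal_ofReal (sub_nonneg.2 h1),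
      ENNReal.toReal_ofReal h0]
  have e : (mixture π).real (A i j) - (huber ε π R).real (A i j) =
      ε * ((mixture π).real (A i j) - R.real (A i j)) := by
    rw [hreal]
    ring
  rw [e, abs_mul, abs_of_nonneg h0]
  refine mul_le_of_le_one_right h0 (abs_sub_le_iff.2 ⟨?_, ?_⟩)
  · linarith [measureReal_le_one (μ := mixture π) (s := A i j),
      measureReal_nonneg (μ := R) (s := A i j)]
  · linarith [measureReal_le_one (μ := R) (s := A i j),
      measureReal_nonneg (μ := mixture π) (s := A i j)]

theorem yatracosDist_le_one {Ω : Type*} [MeasurableSpace Ω] {N : ℕ} (A : Fin N → Fin N → Set Ω)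
    (μ ν : Measure Ω) [IsProbabilityMeasure μ] [IsProbabilityMeasure ν] :
    yatracosDist A μ ν ≤ 1 := by
  refine (yatracosDist_le_iff zero_le_one).2 fun i j _ => abs_sub_le_iff.2 ⟨?_, ?_⟩
  · linarith [measureReal_le_one (μ := μ) (s := A i j), measureReal_nonneg (μ := ν) (s := A i j)]
  · linarith [measureReal_le_one (μ := ν) (s := A i j), measureReal_nonneg (μ := μ) (s := A i j)]

/-- Risk bound for a Yatracos estimator in terms of the number of centres, with a free threshold
`t` for the uniform deviation of the empirical distribution. -/
theorem lintegral_tv_sq_le {n N : ℕ} (hn : 0 < n) {η : ℝ}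
    {Q : Fin N → Measure (EuclideanSpace ℝ (Fin d))}
    {A : Fin N → Fin N → Set (EuclideanSpace ℝ (Fin d))} (hQ : IsTVCover M η Q)
    (hA : IsYatracosClass Q A)
    {Phat : (Fin n → EuclideanSpace ℝ (Fin d)) → Measure (EuclideanSpace ℝ (Fin d))}
    (hP : IsYatracosEstimator M A Phat) {ε : ℝ} (h0 : 0 ≤ ε) (h1 : ε ≤ 1)
    {π R : Measure (EuclideanSpace ℝ (Fin d))} (hπ : IsMixing M π) [IsProbabilityMeasure R]
    {t : ℝ} (ht : 0 ≤ t) :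
    ∫⁻ x, ENNReal.ofReal (tv (mixture π) (Phat x) ^ 2)
        ∂(Measure.pi fun _ : Fin n => huber ε π R) ≤
      ENNReal.ofReal (48 * η ^ 2 + 12 * ε ^ 2 + 12 * t ^ 2 +
        12 * (N ^ 2 * (2 * Real.exp (-2 * n * t ^ 2)))) := by
  have := hπ.1
  have := isProbabilityMeasure_huber h0 h1 π R
  have hemp : ∀ x : Fin n → EuclideanSpace ℝ (Fin d), IsProbabilityMeasure (empirical x) :=
    fun x => isProbabilityMeasure_empirical hn x
  set S : Set (Fin n → EuclideanSpace ℝ (Fin d)) :=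
    {x | t < yatracosDist A (huber ε π R) (empirical x)} with hS
  -- From `(x + y + z)² ≤ 3 * (x² + y² + z²)` with `4 * η`, `2 * ε`, `2 * Z`. Off `S` one has `Z ≤
  -- t`; on `S` only `Z ≤ 1`, which costs the extra `12`.
  have hpt : ∀ x, ENNReal.ofReal (tv (mixture π) (Phat x) ^ 2) ≤
      ENNReal.ofReal (48 * η ^ 2 + 12 * ε ^ 2 + 12 * t ^ 2) + S.indicator (fun _ => 12) x := by
    intro x
    have b1 := tv_le_of_yatracosDist_le hQ hA ⟨π, hπ, rfl⟩ (hP.2 x).1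
      ((hP.2 x).2 _ ⟨π, hπ, rfl⟩)
    have b2 := yatracosDist_triangle A (mixture π) (huber ε π R) (empirical x)
    have b3 := yatracosDist_mixture_huber_le A h0 h1 π R
    have b4 := yatracosDist_le_one A (huber ε π R) (empirical x)
    have b5 := yatracosDist_nonneg A (huber ε π R) (empirical x)
    have b6 := tv_nonneg (mixture π) (Phat x)
    set Z := yatracosDist A (huber ε π R) (empirical x)
    have b7 : tv (mixture π) (Phat x) ^ 2 ≤ (4 * η + 2 * ε + 2 * Z) ^ 2 :=
      pow_le_pow_left₀ b6 (by linarith) 2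
    have b8 : (4 * η + 2 * ε + 2 * Z) ^ 2 ≤ 48 * η ^ 2 + 12 * ε ^ 2 + 12 * Z ^ 2 := by
      nlinarith [sq_nonneg (4 * η - 2 * ε), sq_nonneg (4 * η - 2 * Z), sq_nonneg (2 * ε - 2 * Z)]
    by_cases hx : x ∈ S
    · rw [Set.indicator_of_mem hx, show (12 : ℝ≥0∞) = ENNReal.ofReal 12 by simp,
        ← ENNReal.ofReal_add (by positivity) (by norm_num)]
      refine ENNReal.ofReal_le_ofReal ?_
      nlinarith [sq_nonneg t]
    · rw [Set.indicator_of_notMem hx, add_zero]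
      refine ENNReal.ofReal_le_ofReal ?_
      have : Z ≤ t := not_lt.1 hx
      nlinarith
  refine (lintegral_mono hpt).trans ?_
  rw [lintegral_add_left measurable_const, lintegral_const, measure_univ, mul_one,
    ENNReal.ofReal_add (p := 48 * η ^ 2 + 12 * ε ^ 2 + 12 * t ^ 2) (by positivity) (by positivity)]
  refine add_le_add_right ((lintegral_indicator_const_le _ _).trans ?_) _
  rw [← ofReal_measureReal, show (12 : ℝ≥0∞) = ENNReal.ofReal 12 by simp,
    ← ENNReal.ofReal_mul (by norm_num)]
  exact ENNReal.ofReal_le_ofReal (mul_le_mul_of_nonneg_left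
    (measureReal_lt_yatracosDist_empirical_le hA (huber ε π R) hn ht) (by norm_num))

end Risk

theorem mainTheorem8 (d : ℕ) (hd : 1 ≤ d) (M : ℝ) (hM : 0 ≤ M) (a b : ℝ) (ha : 0 < a) :
    ∃ C : ℝ, 0 < C ∧
      ∀ (n : ℕ) (η : ℝ), 2 ≤ n →
        a * (Real.log n ^ ((d : ℝ) / 2) / √(n : ℝ)) ≤ η →
        η ≤ b * (Real.log n ^ ((d : ℝ) / 2) / √(n : ℝ)) →
        (∃ (N : ℕ) (Q : Fin N → Measure (EuclideanSpace ℝ (Fin d))),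
          IsEconomicalTVCover M η Q) ∧
        ∀ (N : ℕ) (Q : Fin N → Measure (EuclideanSpace ℝ (Fin d)))
          (A : Fin N → Fin N → Set (EuclideanSpace ℝ (Fin d))),
          IsEconomicalTVCover M η Q → IsYatracosClass Q A →
          (∃ Phat : (Fin n → EuclideanSpace ℝ (Fin d)) → Measure (EuclideanSpace ℝ (Fin d)),
            IsYatracosEstimator M A Phat) ∧
          ∀ Phat : (Fin n → EuclideanSpace ℝ (Fin d)) → Measure (EuclideanSpace ℝ (Fin d)),
            IsYatracosEstimator M A Phat →
            ∀ ε : ℝ, 0 ≤ ε → ε ≤ 1 →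
              ⨆ (π : Measure (EuclideanSpace ℝ (Fin d))) (_ : IsMixing M π)
                (R : Measure (EuclideanSpace ℝ (Fin d))) (_ : IsProbabilityMeasure R),
                ∫⁻ x, ENNReal.ofReal (tv (mixture π) (Phat x) ^ 2)
                  ∂(Measure.pi fun _ : Fin n => huber ε π R) ≤
              ENNReal.ofReal (C * (ε ^ 2 + Real.log n ^ (d + 1) / n)) := by
  obtain ⟨C₁, hC₁, hcov⟩ := exists_properCoveringNumber_le d hM ha
  have hl2 : 0 < Real.log 2 := Real.log_pos one_lt_two
  -- `C₁` cancels half of the exponent of `N ^ 2`; the excess makes `2 * (τ - C₁) * ℓ ^ (d + 1) ≥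
  -- ℓ`, so the failure probability is at most `2 / n`.
  set τ : ℝ := C₁ + 1 / (2 * Real.log 2 ^ d) with hτ
  refine ⟨12 + 48 * (b ^ 2 / Real.log 2) + 12 * τ + 24 / Real.log 2 ^ (d + 1), by positivity,
    fun n η hn hη hηb => ?_⟩
  obtain ⟨⟨Q₀, hQ₀, -⟩, hcard⟩ := hcov n η hn hη
  refine ⟨⟨_, Q₀, hQ₀, le_rfl⟩, fun N Q A hQ hA => ⟨exists_isYatracosEstimator hA hM,
    fun Phat hP ε h0 h1 => iSup₂_le fun π hπ => iSup₂_le fun R hR => ?_⟩⟩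
  have hn0 : (0 : ℝ) < n := by positivity
  have hℓ2 : Real.log 2 ≤ Real.log n := Real.log_le_log two_pos (by exact_mod_cast hn)
  have hexpℓ : Real.exp (-Real.log n) = (n : ℝ)⁻¹ := by rw [Real.exp_neg, Real.exp_log hn0]
  set ℓ := Real.log n with hℓ
  have hℓ0 : 0 < ℓ := hl2.trans_le hℓ2
  set t : ℝ := √(τ * (ℓ ^ (d + 1) / n)) with ht
  have htsq : t ^ 2 = τ * (ℓ ^ (d + 1) / n) := Real.sq_sqrt (by positivity)
  refine (lintegral_tv_sq_le (by omega) hQ.1 hA hP h0 h1 hπ (Real.sqrt_nonneg _ : 0 ≤ t)).trans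
    (ENNReal.ofReal_le_ofReal ?_)
  have hN : (N : ℝ) ≤ Real.exp (C₁ * ℓ ^ (d + 1)) := le_trans (by exact_mod_cast hQ.2) hcard
  have hη0 : 0 ≤ η := le_trans (by positivity) hη
  -- The covering error is of the smaller order `ℓ ^ d / n`; one factor `ℓ / log 2 ≥ 1` is given
  -- away.
  have b1 : η ^ 2 ≤ b ^ 2 / Real.log 2 * (ℓ ^ (d + 1) / n) := by
    calc η ^ 2 ≤ (b * (ℓ ^ ((d : ℝ) / 2) / √(n : ℝ))) ^ 2 := pow_le_pow_left₀ hη0 hηb 2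
      _ = b ^ 2 / Real.log 2 * (ℓ ^ d * Real.log 2 / n) := by
          rw [mul_pow, sq_rpow_half_div_sqrt hℓ0.le]
          field_simp
      _ ≤ b ^ 2 / Real.log 2 * (ℓ ^ (d + 1) / n) := by
          rw [pow_succ ℓ]
          gcongr
  have b2 : (N : ℝ) ^ 2 * (2 * Real.exp (-2 * n * t ^ 2)) ≤
      2 / Real.log 2 ^ (d + 1) * (ℓ ^ (d + 1) / n) := by
    have e1 : -2 * n * t ^ 2 = -2 * τ * ℓ ^ (d + 1) := by
      rw [htsq]
      field_simp
    have e2 : ℓ ≤ 2 * (τ - C₁) * ℓ ^ (d + 1) := by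
      have e3 : 2 * (τ - C₁) = 1 / Real.log 2 ^ d := by
        rw [hτ]
        field_simp
        ring
      rw [e3, div_mul_eq_mul_div, one_mul, le_div_iff₀ (by positivity), pow_succ, mul_comm]
      gcongr
    calc (N : ℝ) ^ 2 * (2 * Real.exp (-2 * n * t ^ 2))
        ≤ Real.exp (C₁ * ℓ ^ (d + 1)) ^ 2 * (2 * Real.exp (-2 * n * t ^ 2)) := by gcongr
      _ = 2 * Real.exp (2 * (C₁ * ℓ ^ (d + 1)) + -2 * τ * ℓ ^ (d + 1)) := by
          rw [e1, ← Real.exp_nat_mul, Real.exp_add]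
          push_cast
          ring
      _ ≤ 2 * Real.exp (-ℓ) := by
          gcongr
          linarith
      _ = 2 / Real.log 2 ^ (d + 1) * (Real.log 2 ^ (d + 1) / n) := by
          rw [hexpℓ]
          field_simp
      _ ≤ 2 / Real.log 2 ^ (d + 1) * (ℓ ^ (d + 1) / n) := by gcongr
  rw [htsq] at b2 ⊢
  have b3 : 0 ≤ (48 * (b ^ 2 / Real.log 2) + 12 * τ + 24 / Real.log 2 ^ (d + 1)) * ε ^ 2 := by
    positivity
  have b4 : 0 ≤ ℓ ^ (d + 1) / n := by positivity
  have b5 : 24 / Real.log 2 ^ (d + 1) = 12 * (2 / Real.log 2 ^ (d + 1)) := by ring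
  rw [b5] at b3 ⊢
  linarith
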